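/- Let $d \in \mathbb{N} \cup \{\infty\}$ and let $\mathbb{H}^2_d$ be the full Fock space of all power series $h = \sum_\omega \hat h_\omega \mathfrak{z}^\omega$ in $d$ non-commuting variables with $\sum_\omega |\hat h_\omega|^2 < \infty$, where $\omega$ runs over the words in the letters $1, \dots, d$. Inner products are conjugate-linear in the first argument. Let $L_k$ be left multiplication by $\mathfrak{z}_k$ and let $\mathbb{H}^\infty_d$ be the algebra of left multipliers, i.e. of the power series $F$ for which $F(L) : h \mapsto F h$ is a bounded operator on $\mathbb{H}^2_d$. For $F = \sum_\omega \hat F_\omega \mathfrak{z}^\omega \in \mathbb{H}^\infty_d$ put $F(0) = \hat F_\emptyset$, $F^{\mathrm t} = \sum_\omega \hat F_\omega \mathfrak{z}^{\omega^{\mathrm t}}$, where $\omega^{\mathrm t}$ is $\omega$ with its letters reversed, and let $F(R) : h \mapsto h F^{\mathrm t}$; $F$ is contractive if $\|F(L)\| = \|F(R)\| \le 1$, and outer if $F(R)$ has dense range. For a finite column $c$ of elements of $\mathbb{H}^\infty_d$, the operators $c(L), c(R) : \mathbb{H}^2_d \to \mathbb{H}^2_d \otimes \mathbb{C}^n$ and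 $c^{\mathrm t}$ are defined entrywise. A contractive multiplier (or column) $c$ is column-extreme (CE) if the only multiplier (column of the same size) $f$ for which $\left(\begin{smallmatrix} c \\ f \end{smallmatrix}\right)$ is contractive is $f = 0$. For contractive $c$, let $\mathscr{H}^{\mathrm t}(c)$ be the range of $\sqrt{I - c(R) c(R)^*}$ with the Hilbert space norm $\|\cdot\|_c$ that makes this operator a co-isometry onto its range, and let $\boldsymbol{c} = (L_k^* \otimes I\, c^{\mathrm t})_{k} \in \mathscr{H}^{\mathrm t}(c) \otimes \mathbb{C}^d$, with the norm, again written $\|\cdot\|_c$, of this Hilbert space. A bounded operator on $\mathbb{H}^2_d$ is factorizable if it equals $f(R)^* f(R)$ for some $f \in \mathbb{H}^\infty_d$; the maximal factorizable minorant of $T \ge 0$ is the greatest factorizable operator $T_0 \le T$. Let $b \in \mathbb{H}^\infty_d$ be contractive and not column-extreme. Then $L_k^*$ restricts to a bounded operator $X_k$ on $\mathscr{H}^{\mathrm t}(b)$, $b^{\mathrm t} \in \mathscr{H}^{\mathrm t}(b)$, $1 - |b(0)|^2 - \|\boldsymbol{b}\|_b^2 > 0$, and there is a unique $a \in \mathbb{H}^\infty_d$,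 the NC Sarason function of $b$, with $$ a(0) = \sqrt{1 - |b(0)|^2 - \|\boldsymbol{b}\|_b^2}, \qquad \hat a_\omega = -a(0)\, \langle b^{\mathrm t}, X^\omega b^{\mathrm t} \rangle_b \quad (\omega \neq \emptyset), $$ where $X^\omega = X_{i_1} \cdots X_{i_n}$ for $\omega = i_1 \cdots i_n$. Moreover, $a$ is contractive and has the following properties. 1. $a$ is outer and $a(R)^* a(R)$ is the maximal factorizable minorant of $I - b(R)^* b(R)$. 2. $a(0)^2 = \inf_p \langle 1 - p, (I - b(R)^* b(R))(1 - p) \rangle_{\mathbb{H}^2_d}$, the infimum being over all free polynomials $p$ in $\mathfrak{z}_1, \mathfrak{z}_2, \dots$ with $p(0) = 0$. 3. The column $c = \left(\begin{smallmatrix} b \\ a \end{smallmatrix}\right)$ is contractive and column-extreme, and $\|\boldsymbol{c}\|_c = \|\boldsymbol{b}\|_b$. -/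

import Mathlib

open scoped InnerProductSpace InnerProduct

noncomputable section

namespace FreeSarason

/-! ### Operator-range spaces and complementary spaces -/

section OperatorRange

variable {K H : Type*} [NormedAddCommGroup K] [InnerProductSpace ℂ K] [CompleteSpace K]
  [NormedAddCommGroup H] [InnerProductSpace ℂ H]

/-- The operator-range space `𝓜(A)`: as a vector space it is `Ran A`; its inner product, defined
below, is the one for which `A` is a co-isometry onto its range. -/
def OperatorRange (A : K →L[ℂ] H) : Type _ := LinearMap.range (A : K →ₗ[ℂ] H)

namespace OperatorRange

variable (A : K →L[ℂ] H)

instance : AddCommGroup (OperatorRange A) :=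
  inferInstanceAs (AddCommGroup (LinearMap.range (A : K →ₗ[ℂ] H)))

instance : Module ℂ (OperatorRange A) :=
  inferInstanceAs (Module ℂ (LinearMap.range (A : K →ₗ[ℂ] H)))

/-- The inclusion `𝓜(A) ⊆ H`. -/
def incl : OperatorRange A →ₗ[ℂ] H := (LinearMap.range (A : K →ₗ[ℂ] H)).subtype

theorem isCompl_ker :
    IsCompl (LinearMap.ker (A : K →ₗ[ℂ] H))ᗮ (LinearMap.ker (A : K →ₗ[ℂ] H)) := by
  have : CompleteSpace (LinearMap.ker (A : K →ₗ[ℂ] H)) :=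
    (ContinuousLinearMap.isClosed_ker A).completeSpace_coe
  exact (Submodule.isCompl_orthogonal _).symm

/-- `A` restricts to a linear isomorphism of `(ker A)ᗮ` onto `𝓜(A)`. -/
def kerPerpEquiv : (LinearMap.ker (A : K →ₗ[ℂ] H))ᗮ ≃ₗ[ℂ] OperatorRange A :=
  LinearMap.kerComplementEquivRange (A : K →ₗ[ℂ] H) (isCompl_ker A)

theorem incl_kerPerpEquiv (x : (LinearMap.ker (A : K →ₗ[ℂ] H))ᗮ) :
    incl A (kerPerpEquiv A x) = A x := rfl

instance : NormedAddCommGroup (OperatorRange A) :=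
  NormedAddCommGroup.induced (OperatorRange A) (LinearMap.ker (A : K →ₗ[ℂ] H))ᗮ
    (kerPerpEquiv A).symm.toLinearMap (kerPerpEquiv A).symm.injective

instance : InnerProductSpace ℂ (OperatorRange A) where
  norm_smul_le c x := by
    change ‖(kerPerpEquiv A).symm (c • x)‖ ≤ ‖c‖ * ‖(kerPerpEquiv A).symm x‖
    rw [map_smul, norm_smul]
  inner x y := inner ℂ ((kerPerpEquiv A).symm x) ((kerPerpEquiv A).symm y)
  norm_sq_eq_re_inner x := norm_sq_eq_re_inner (𝕜 := ℂ) ((kerPerpEquiv A).symm x)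
  conj_inner_symm x y := inner_conj_symm _ _
  add_left x y z := by
    simp only [map_add, inner_add_left]
  smul_left x y c := by
    simp only [map_smul, inner_smul_left]

/-- `A` maps `(ker A)ᗮ` isometrically onto `𝓜(A)`, i.e. `A : K → 𝓜(A)` is a co-isometry. -/
theorem inner_kerPerpEquiv (x y : (LinearMap.ker (A : K →ₗ[ℂ] H))ᗮ) :
    inner ℂ (kerPerpEquiv A x) (kerPerpEquiv A y) = inner ℂ (x : K) (y : K) := by
  change inner ℂ ((kerPerpEquiv A).symm (kerPerpEquiv A x))
    ((kerPerpEquiv A).symm (kerPerpEquiv A y)) = _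
  simp

end OperatorRange

/-- The complementary space `𝓜(√(I - T T*))` of a contraction `T`. -/
abbrev ComplementarySpace [CompleteSpace H] (T : K →L[ℂ] H) : Type _ :=
  OperatorRange (CFC.sqrt (1 - T ∘L T†) : H →L[ℂ] H)

end OperatorRange

/-! ### The full Fock space -/

variable {ι : Type*}

/-- The full Fock space (free Hardy space) over the letters `ι`: square-summable power series
`∑ h_ω z^ω`, where `ω` runs over the words in `ι`. -/
abbrev Fock (ι : Type*) : Type _ := lp (fun _ : List ι => ℂ) 2

/-- Product of formal power series in the non-commuting variables `z_i`, `i : ι`: the coefficient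
of `z^ω` is the sum of `f_α g_β` over all factorizations `ω = αβ`. -/
def ncMul (f g : List ι → ℂ) (w : List ι) : ℂ :=
  ∑ n ∈ Finset.range (w.length + 1), f (w.take n) * g (w.drop n)

open Classical in
/-- The vacuum vector `1 = z^∅`. -/
def vacuum (ι : Type*) : Fock ι := lp.single 2 ([] : List ι) (1 : ℂ)

theorem memlp_comp {φ : List ι → List ι} (hφ : Function.Injective φ) (h : Fock ι) :
    Memℓp (fun w => h (φ w)) 2 := by
  have h2 : 0 < (2 : ENNReal).toReal := by norm_num
  exact memℓp_gen (((lp.memℓp h).summable h2).comp_injective hφ)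

/-- The contraction `h ↦ (h_{φ(ω)})_ω` on Fock space, for an injective `φ`. -/
def compOp (φ : List ι → List ι) (hφ : Function.Injective φ) : Fock ι →L[ℂ] Fock ι :=
  LinearMap.mkContinuous
    { toFun := fun h => ⟨fun w => h (φ w), memlp_comp hφ h⟩
      map_add' := fun _ _ => rfl
      map_smul' := fun _ _ => rfl } 1 (by
    intro h
    have h2 : 0 < (2 : ENNReal).toReal := by norm_num
    rw [one_mul]
    refine lp.norm_le_of_tsum_le h2 (norm_nonneg h) ?_
    rw [lp.norm_rpow_eq_tsum h2 h]
    exact tsum_comp_le_tsum_of_inj ((lp.memℓp h).summable h2) (fun _ => by positivity) hφ)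

theorem compOp_apply (φ : List ι → List ι) (hφ : Function.Injective φ) (h : Fock ι)
    (w : List ι) : compOp φ hφ h w = h (φ w) := rfl

/-- The letter reversal `U_t`, `z^ω ↦ z^{ω^t}`. -/
def flip : Fock ι →L[ℂ] Fock ι := compOp List.reverse List.reverse_injective

/-- The left free shift `L_k`, multiplication by `z_k` from the left (see `leftShift_apply`). It is
introduced as the adjoint of `h ↦ (h_{kω})_ω`. -/
def leftShift (k : ι) : Fock ι →L[ℂ] Fock ι :=
  (compOp (fun w => k :: w) (List.cons_injective))†

theorem adjoint_leftShift_apply (k : ι) (h : Fock ι) (w : List ι) :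
    ((leftShift k)†) h w = h (k :: w) := by
  rw [leftShift, ContinuousLinearMap.adjoint_adjoint]
  rfl

open Classical in
theorem leftShift_apply (k : ι) (h : Fock ι) (w : List ι) :
    (leftShift k h) w = ncMul (Pi.single [k] 1) h w := by
  have key : (leftShift k h) w =
      inner ℂ (compOp (fun w => k :: w) List.cons_injective (lp.single 2 w (1 : ℂ))) h := by
    rw [leftShift, ← ContinuousLinearMap.adjoint_inner_right, lp.inner_single_left]
    simp
  rw [key]
  cases w with
  | nil =>
    have : compOp (fun w => k :: w) List.cons_injective (lp.single 2 ([] : List ι) (1 : ℂ))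
        = 0 := by
      apply lp.ext
      funext v
      rw [compOp_apply, lp.single_apply]
      simp
    rw [this]
    simp [ncMul]
  | cons j v =>
    have hs : ncMul (Pi.single [k] 1) h (j :: v) = if j = k then h v else 0 := by
      rw [ncMul, Finset.sum_eq_single 1]
      · by_cases hjk : j = k
        · simp [hjk]
        · have : ([j] : List ι) ≠ [k] := by simpa using hjk
          simp [hjk]
      · intro n hn h1
        have : (j :: v).take n ≠ [k] := by
          intro hh
          have := congrArg List.length hh
          simp only [List.length_take, List.length_cons, List.length_nil] at this
          simp only [Finset.mem_range, List.length_cons] at hn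
          omega
        simp [this]
      · intro hh
        simp at hh
    rw [hs]
    by_cases hjk : j = k
    · subst hjk
      have : compOp (fun w => j :: w) List.cons_injective (lp.single 2 (j :: v) (1 : ℂ))
          = lp.single 2 v (1 : ℂ) := by
        apply lp.ext
        funext u
        rw [compOp_apply, lp.single_apply, lp.single_apply]
        simp [Pi.single_apply]
      rw [this, lp.inner_single_left]
      simp
    · have : compOp (fun w => k :: w) List.cons_injective (lp.single 2 (j :: v) (1 : ℂ))
          = 0 := by
        apply lp.ext
        funext u
        rw [compOp_apply, lp.single_apply]
        simp [Ne.symm hjk]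
      rw [this]
      simp [hjk]

/-! ### The free Hardy algebra and column multipliers -/

/-- The free Hardy algebra `ℍ^∞`, i.e. the left multiplier algebra of Fock space: formal power
series `F` for which `F(L) : h ↦ F h` is a bounded operator on Fock space. The operator is
determined by the series. -/
structure Hinf (ι : Type*) where
  /-- the Taylor coefficients `F̂_ω` -/
  coeff : List ι → ℂ
  /-- the operator `F(L)` -/
  opL : Fock ι →L[ℂ] Fock ι
  opL_apply : ∀ (h : Fock ι) (w : List ι), opL h w = ncMul coeff h w

namespace Hinf

/-- `F(R) = U_t F(L) U_t`, right multiplication by `F^t` (see `opR_apply`). -/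
def opR (F : Hinf ι) : Fock ι →L[ℂ] Fock ι := flip ∘L F.opL ∘L flip

theorem opR_apply (F : Hinf ι) (h : Fock ι) (w : List ι) :
    F.opR h w = ncMul h (fun v => F.coeff v.reverse) w := by
  change F.opL (flip h) w.reverse = _
  rw [F.opL_apply, ncMul, ncMul, ← Finset.sum_range_reflect, List.length_reverse]
  refine Finset.sum_congr rfl fun n hn => ?_
  rw [Finset.mem_range] at hn
  have e : w.length + 1 - 1 - n = w.length - n := by omega
  change _ * h (List.reverse _) = _
  rw [e, List.drop_reverse, List.take_reverse, List.reverse_reverse, mul_comm]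
  have e2 : w.length - (w.length - n) = n := by omega
  rw [e2]

/-- The vector `F^t = F(R) 1` of Fock space, `F^t = ∑ F̂_ω z^{ω^t}`. -/
def transpose (F : Hinf ι) : Fock ι := F.opR (vacuum ι)

theorem transpose_apply (F : Hinf ι) (w : List ι) : F.transpose w = F.coeff w.reverse := by
  classical
  rw [transpose, opR_apply, ncMul, Finset.sum_eq_single 0]
  · simp [vacuum, lp.single_apply]
  · intro n hn h0
    have : w.take n ≠ [] := by
      intro hh
      have := congrArg List.length hh
      simp only [List.length_take, List.length_nil] at this
      rw [Finset.mem_range] at hn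
      omega
    simp [vacuum, lp.single_apply, this]
  · intro hh
    simp at hh

/-- A multiplier is outer if it has dense range. -/
def IsOuter (F : Hinf ι) : Prop := DenseRange F.opR

end Hinf

/-- The column `h ↦ (T_j h)_j` from Fock space into the Hilbert space direct sum of copies of Fock
space. -/
def column {κ : Type*} [Fintype κ] (T : κ → Fock ι →L[ℂ] Fock ι) :
    Fock ι →L[ℂ] PiLp 2 (fun _ : κ => Fock ι) :=
  ((PiLp.continuousLinearEquiv 2 ℂ (fun _ : κ => Fock ι)).symm :
    (∀ _ : κ, Fock ι) →L[ℂ] PiLp 2 (fun _ : κ => Fock ι)) ∘L ContinuousLinearMap.pi T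

theorem column_apply {κ : Type*} [Fintype κ] (T : κ → Fock ι →L[ℂ] Fock ι) (h : Fock ι) (j : κ) :
    column T h j = T j h := rfl

/-- `c(L)` for a column `c` of multipliers. -/
def colL {κ : Type*} [Fintype κ] (c : κ → Hinf ι) : Fock ι →L[ℂ] PiLp 2 (fun _ : κ => Fock ι) :=
  column fun j => (c j).opL

/-- `c(R)` for a column `c` of multipliers. -/
def colR {κ : Type*} [Fintype κ] (c : κ → Hinf ι) : Fock ι →L[ℂ] PiLp 2 (fun _ : κ => Fock ι) :=
  column fun j => (c j).opR

/-- A contractive multiplier `b` is column-extreme if there is no non-zero multiplier `a` for which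
the column `(b; a)` is contractive. -/
def IsColumnExtreme (b : Hinf ι) : Prop :=
  ‖b.opL‖ ≤ 1 ∧ ∀ a : Hinf ι, ‖colL ![b, a]‖ ≤ 1 → ∀ w, a.coeff w = 0

/-- A contractive column `c` of multipliers is column-extreme if there is no non-zero column `a` of
the same size for which the column `(c; a)` is contractive. -/
def IsColumnExtremeCol {κ : Type*} [Fintype κ] (c : κ → Hinf ι) : Prop :=
  ‖colL c‖ ≤ 1 ∧
    ∀ a : κ → Hinf ι, ‖colL (Sum.elim c a)‖ ≤ 1 → ∀ j w, (a j).coeff w = 0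

/-! ### De Branges–Rovnyak spaces and the Sarason function -/

/-- The right free de Branges–Rovnyak space `𝓗^t(b) = 𝓜(√(I - b(R) b(R)*))`. -/
abbrev Ht (b : Hinf ι) : Type _ := ComplementarySpace b.opR

/-- The inclusion `𝓗^t(b) ⊆ ℍ²`. -/
abbrev Ht.incl (b : Hinf ι) : Ht b →ₗ[ℂ] Fock ι := OperatorRange.incl _

/-- The right free de Branges–Rovnyak space `𝓗^t(c) = 𝓜(√(I - c(R) c(R)*))` of a column. -/
abbrev HtCol {κ : Type*} [Fintype κ] (c : κ → Hinf ι) : Type _ := ComplementarySpace (colR c)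

/-- The inclusion `𝓗^t(c) ⊆ ℍ² ⊗ ℂ^κ`. -/
abbrev HtCol.incl {κ : Type*} [Fintype κ] (c : κ → Hinf ι) :
    HtCol c →ₗ[ℂ] PiLp 2 (fun _ : κ => Fock ι) := OperatorRange.incl _

/-- `𝐛 = L* b^t`, as an element of `𝓗^t(b) ⊗ ℂ^d` (the `ℓ²`-direct sum of copies of `𝓗^t(b)`
indexed by the letters). -/
def IsBackwardShift (b : Hinf ι) (bb : lp (fun _ : ι => Ht b) 2) : Prop :=
  ∀ k, Ht.incl b (bb k) = ((leftShift k)†) b.transpose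

/-- `𝐜 = (L* ⊗ I) c^t`, as an element of `𝓗^t(c) ⊗ ℂ^d`. -/
def IsBackwardShiftCol {κ : Type*} [Fintype κ] (c : κ → Hinf ι)
    (cc : lp (fun _ : ι => HtCol c) 2) : Prop :=
  ∀ k j, HtCol.incl c (cc k) j = ((leftShift k)†) (c j).transpose

/-- `a` is the Sarason function of `b`. With `X_k` the restriction of `L_k*` to `𝓗^t(b)`, with
`b^t ∈ 𝓗^t(b)` and `𝐛 = L* b^t ∈ 𝓗^t(b) ⊗ ℂ^d`, its Taylor coefficients are
`a(0) = √(1 - |b(0)|² - ‖𝐛‖²) > 0` and `â_ω = - a(0) ⟨b^t, X^ω b^t⟩` for `ω ≠ ∅`; the inner product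
is conjugate-linear in the first argument, and `X^ω = X_{i₁} ⋯ X_{iₙ}` for `ω = i₁ ⋯ iₙ`. -/
def IsSarasonFunction (b a : Hinf ι) : Prop :=
  ∃ (X : ι → Ht b →L[ℂ] Ht b) (bt : Ht b) (bb : lp (fun _ : ι => Ht b) 2),
    (∀ k f, Ht.incl b (X k f) = ((leftShift k)†) (Ht.incl b f)) ∧
    Ht.incl b bt = b.transpose ∧
    IsBackwardShift b bb ∧
    0 < 1 - ‖b.coeff []‖ ^ 2 - ‖bb‖ ^ 2 ∧
    a.coeff [] = (Real.sqrt (1 - ‖b.coeff []‖ ^ 2 - ‖bb‖ ^ 2) : ℂ) ∧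
    ∀ w, w ≠ [] → a.coeff w = -a.coeff [] * inner ℂ bt ((w.map X).prod bt)

/-! ### Factorizable minorants and free polynomials -/

/-- `T` is factorizable if `T = f(R)* f(R)` for some `f` in the free Hardy algebra. -/
def IsFactorizable (T : Fock ι →L[ℂ] Fock ι) : Prop :=
  ∃ f : Hinf ι, T = f.opR† ∘L f.opR

/-- `T₀` is the maximal factorizable minorant of `T`: the greatest factorizable operator below `T`
in the operator order. -/
def IsMaximalFactorizableMinorant (T T₀ : Fock ι →L[ℂ] Fock ι) : Prop :=
  IsGreatest {S | IsFactorizable S ∧ S ≤ T} T₀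

/-- Free polynomials, as vectors of Fock space. -/
def IsFreePolynomial (p : Fock ι) : Prop := {w : List ι | p w ≠ 0}.Finite

end FreeSarason

end

/-! Put `D = √(I - b(R)* b(R))`. Because `b(R)` commutes with the left shifts, `D²` is a Toeplitz
operator: `L_k* D² L_j = δ_{kj} D²`. The argument is Szegő theory for `D²`. Let `u` be the component
of `D 1` orthogonal to all `D p` with `p` a free polynomial and `p(0) = 0`. Then `‖u‖²` is the
infimum in property 2, and `⟨u, D h⟩ = h(0) ‖u‖²`. A non-zero `f` that keeps `(b; f)` contractive is
bounded below on the series with constant term `1`, so `u ≠ 0` when `b` is not column-extreme.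

The maps `W^ω : D x ↦ D z^ω x` carry `u` to an orthogonal family (`inner_lift_lift`), so `J : z^ω ↦
W^ω u / ‖u‖` is an isometry. The operator `S = J* D` commutes with the left shifts, hence equals
`a(R)` for a multiplier `a`; it has dense range and dominates every multiplier dominated by `D`
(`isOuterFactor_of_isometry`).

The coefficients of `a` are matched with the Sarason formula through the inner product of the
complementary space, `⟨f₁, f₂⟩_b = ⟨f₁, f₂⟩ + ⟨z₁, z₂⟩` where `b(R)* f_i = D z_i`
(`inner_complementarySpace`). Explicit solutions `z` are available for `b^t` and for its backward
shifts, and completing a square gives `‖𝐛‖² = 1 - |b(0)|² - ‖u‖²` (`hasSum_norm_sq_shiftDefect`).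
After `S* S` is removed from `D²`, the Szegő infimum is `0`. This yields column-extremality of `(b;
a)`, and the same norm formula for the column gives `‖𝐜‖ = ‖𝐛‖`. -/

set_option linter.unusedSectionVars false

open scoped InnerProductSpace InnerProduct

noncomputable section

namespace FreeSarason

/-! ### Douglas factorization -/

section OperatorTheory

variable {E F G : Type*} [NormedAddCommGroup E] [InnerProductSpace ℂ E]
  [NormedAddCommGroup F] [InnerProductSpace ℂ F] [CompleteSpace F]
  [NormedAddCommGroup G] [InnerProductSpace ℂ G] [CompleteSpace G]

/-- Douglas factorization: `‖A x‖ ≤ ‖B x‖` for all `x` implies `A = W B` for a contraction `W`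
which vanishes on the orthogonal complement of the range of `B`. -/
theorem exists_contraction_comp_eq (A : E →L[ℂ] G) (B : E →L[ℂ] F) (h : ∀ x, ‖A x‖ ≤ ‖B x‖) :
    ∃ W : F →L[ℂ] G, (∀ y, ‖W y‖ ≤ ‖y‖) ∧ (∀ x, W (B x) = A x) ∧
      ∀ y, (∀ x, inner ℂ (B x) y = 0) → W y = 0 := by
  let R := (LinearMap.range (B : E →ₗ[ℂ] F)).topologicalClosure
  have : CompleteSpace R := (Submodule.isClosed_topologicalClosure _).completeSpace_coe
  have hmem : ∀ x, B x ∈ R := fun x => Submodule.le_topologicalClosure _ ⟨x, rfl⟩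
  let e : E →ₗ[ℂ] R := (B : E →ₗ[ℂ] F).codRestrict R hmem
  have hd : DenseRange e := by
    rw [DenseRange, Subtype.dense_iff]
    intro y hy
    have : (Subtype.val '' Set.range e) = Set.range B := by
      ext z; constructor
      · rintro ⟨_, ⟨x, rfl⟩, rfl⟩; exact ⟨x, rfl⟩
      · rintro ⟨x, rfl⟩; exact ⟨e x, ⟨x, rfl⟩, rfl⟩
    have h2 : y ∈ ((LinearMap.range (B : E →ₗ[ℂ] F)).topologicalClosure : Set F) := hy
    rw [Submodule.topologicalClosure_coe] at h2
    exact this ▸ h2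
  have hn : ∀ x, ‖(A : E →ₗ[ℂ] G) x‖ ≤ 1 * ‖e x‖ := fun x => by
    rw [one_mul]; exact h x
  -- `B x ↦ A x` is extended by continuity to the closure of the range of `B`; precomposing with the
  -- orthogonal projection makes it vanish on the complement.
  refine ⟨(LinearMap.extendOfNorm (A : E →ₗ[ℂ] G) e) ∘L R.orthogonalProjectionOnto,
    fun y => ?_, fun x => ?_, fun y hy => ?_⟩
  · refine (LinearMap.norm_extendOfNorm_apply_le hd 1 hn _).trans ?_
    rw [one_mul]
    exact R.norm_orthogonalProjectionOnto_apply_le y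
  · have : R.orthogonalProjectionOnto (B x) = e x :=
      R.orthogonalProjectionOnto_mem_subspace_eq_self (e x)
    rw [ContinuousLinearMap.comp_apply, this]
    exact LinearMap.extendOfNorm_eq hd ⟨1, hn⟩ x
  · have : R.orthogonalProjectionOnto y = 0 := by
      rw [Submodule.orthogonalProjectionOnto_eq_zero_iff]
      change y ∈ ((LinearMap.range (B : E →ₗ[ℂ] F)).topologicalClosure)ᗮ
      rw [Submodule.orthogonal_closure, Submodule.mem_orthogonal]
      rintro _ ⟨x, rfl⟩
      exact hy x
    rw [ContinuousLinearMap.comp_apply, this, map_zero]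

end OperatorTheory

/-! ### Square roots of intertwined positive contractions -/

section Intertwining

variable {K H : Type*} [NormedAddCommGroup K] [InnerProductSpace ℂ K] [CompleteSpace K]
  [NormedAddCommGroup H] [InnerProductSpace ℂ H] [CompleteSpace H]

theorem comp_aeval_of_intertwine {A : K →L[ℂ] K} {B : H →L[ℂ] H} {T : K →L[ℂ] H}
    (h : T ∘L A = B ∘L T) (p : Polynomial ℝ) :
    T ∘L (Polynomial.aeval A p) = (Polynomial.aeval B p) ∘L T := by
  induction p using Polynomial.induction_on' with
  | add p q hp hq => simp only [map_add, ContinuousLinearMap.comp_add,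
      ContinuousLinearMap.add_comp, hp, hq]
  | monomial n c =>
    have hn : T ∘L (A ^ n) = (B ^ n) ∘L T := by
      induction n with
      | zero => rfl
      | succ n ih =>
        ext x
        have h1 := fun x => DFunLike.congr_fun h x
        have h2 := fun x => DFunLike.congr_fun ih x
        simp only [ContinuousLinearMap.comp_apply] at h1 h2
        simp only [pow_succ, ContinuousLinearMap.mul_def, ContinuousLinearMap.comp_apply, h1, h2]
    ext x
    have h2 := DFunLike.congr_fun hn x
    simp only [ContinuousLinearMap.comp_apply] at h2
    simpa [Polynomial.aeval_monomial, Algebra.algebraMap_eq_smul_one] using congrArg (c • ·) h2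

theorem cfcSqrt_eq_cfc_real {A : K →L[ℂ] K} (hA : 0 ≤ A) : CFC.sqrt A = cfc Real.sqrt A := by
  rw [CFC.sqrt_eq_real_sqrt A hA, cfcₙ_eq_cfc]

theorem spectrum_subset_Icc {A : K →L[ℂ] K} (hA : 0 ≤ A) (hA1 : A ≤ 1) :
    spectrum ℝ A ⊆ Set.Icc 0 1 := by
  intro x hx
  refine ⟨spectrum_nonneg_of_nonneg hA hx, ?_⟩
  have := (le_algebraMap_iff_spectrum_le (r := (1 : ℝ)) (a := A)
    (IsSelfAdjoint.of_nonneg hA)).1 (by simpa using hA1)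
  exact this x hx

theorem norm_aeval_sub_cfc_sqrt_le {A : K →L[ℂ] K} (hA : 0 ≤ A) (hA1 : A ≤ 1)
    (p : Polynomial ℝ) {ε : ℝ} (hε : 0 < ε)
    (hp : ∀ x ∈ Set.Icc (0 : ℝ) 1, |p.eval x - Real.sqrt x| < ε) :
    ‖Polynomial.aeval A p - cfc Real.sqrt A‖ ≤ ε := by
  rw [← cfc_polynomial p A (IsSelfAdjoint.of_nonneg hA),
    ← cfc_sub (fun x => p.eval x) Real.sqrt A]
  exact norm_cfc_le hε.le fun x hx => (hp x (spectrum_subset_Icc hA hA1 hx)).le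

/-- Intertwining passes to polynomials in the two operators. Both spectra lie in `[0, 1]`, where
Weierstrass approximates the square root by one polynomial for both. -/
theorem comp_cfcSqrt_of_intertwine {A : K →L[ℂ] K} {B : H →L[ℂ] H} {T : K →L[ℂ] H}
    (hA : 0 ≤ A) (hA1 : A ≤ 1) (hB : 0 ≤ B) (hB1 : B ≤ 1) (h : T ∘L A = B ∘L T) :
    T ∘L CFC.sqrt A = CFC.sqrt B ∘L T := by
  rw [cfcSqrt_eq_cfc_real hA, cfcSqrt_eq_cfc_real hB]
  rw [← sub_eq_zero, ← norm_le_zero_iff]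
  refine le_of_forall_pos_le_add fun δ hδ => ?_
  rw [zero_add]
  -- The two approximation errors contribute `2 ε ‖T‖`; the `+ 1` keeps the denominator positive
  -- when `T = 0`.
  set ε := δ / (2 * (‖T‖ + 1)) with hεd
  have hT : 0 < ‖T‖ + 1 := by positivity
  have hε : 0 < ε := by positivity
  obtain ⟨p, hp⟩ := exists_polynomial_near_of_continuousOn 0 1 Real.sqrt
    Real.continuous_sqrt.continuousOn ε hε
  have e1 := norm_aeval_sub_cfc_sqrt_le hA hA1 p hε hp
  have e2 := norm_aeval_sub_cfc_sqrt_le hB hB1 p hε hp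
  have e3 : T ∘L cfc Real.sqrt A - cfc Real.sqrt B ∘L T =
      (Polynomial.aeval B p - cfc Real.sqrt B) ∘L T -
        T ∘L (Polynomial.aeval A p - cfc Real.sqrt A) := by
    rw [ContinuousLinearMap.sub_comp, ContinuousLinearMap.comp_sub, comp_aeval_of_intertwine h]
    abel
  rw [e3]
  calc _ ≤ ‖Polynomial.aeval B p - cfc Real.sqrt B‖ * ‖T‖ +
        ‖T‖ * ‖Polynomial.aeval A p - cfc Real.sqrt A‖ :=
        (norm_sub_le _ _).trans (add_le_add (ContinuousLinearMap.opNorm_comp_le _ _)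
          (ContinuousLinearMap.opNorm_comp_le _ _))
    _ ≤ ε * ‖T‖ + ‖T‖ * ε := by gcongr
    _ ≤ 2 * (ε * (‖T‖ + 1)) := by nlinarith [norm_nonneg T]
    _ = δ := by rw [hεd]; field_simp

end Intertwining

/-! ### Operator-range spaces -/

namespace OperatorRange

variable {K H : Type*} [NormedAddCommGroup K] [InnerProductSpace ℂ K] [CompleteSpace K]
  [NormedAddCommGroup H] [InnerProductSpace ℂ H] (A : K →L[ℂ] H)

theorem incl_injective : Function.Injective (incl A) :=
  (LinearMap.range (A : K →ₗ[ℂ] H)).injective_subtype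

/-- `A` as a map onto its operator-range space. -/
def mk : K →ₗ[ℂ] OperatorRange A := (A : K →ₗ[ℂ] H).rangeRestrict

theorem incl_mk (x : K) : incl A (mk A x) = A x := rfl

theorem exists_mk_eq (f : OperatorRange A) : ∃ x : K, mk A x = f ∧ ‖x‖ = ‖f‖ := by
  refine ⟨((kerPerpEquiv A).symm f : K), ?_, rfl⟩
  apply incl_injective
  rw [incl_mk, ← incl_kerPerpEquiv, LinearEquiv.apply_symm_apply]

theorem inner_mk {x y : K} (hx : ∀ v, A v = 0 → inner ℂ v x = 0)
    (hy : ∀ v, A v = 0 → inner ℂ v y = 0) : inner ℂ (mk A x) (mk A y) = inner ℂ x y := by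
  have hx' : x ∈ (LinearMap.ker (A : K →ₗ[ℂ] H))ᗮ := (Submodule.mem_orthogonal _ _).2 hx
  have hy' : y ∈ (LinearMap.ker (A : K →ₗ[ℂ] H))ᗮ := (Submodule.mem_orthogonal _ _).2 hy
  exact inner_kerPerpEquiv A ⟨x, hx'⟩ ⟨y, hy'⟩

/-- The range norm is that of the preimage in `(ker A)ᗮ`, and projecting `x` there changes neither
`A x` nor increases the norm. -/
theorem norm_mk_le (x : K) : ‖mk A x‖ ≤ ‖x‖ := by
  have : CompleteSpace (LinearMap.ker (A : K →ₗ[ℂ] H)) :=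
    (ContinuousLinearMap.isClosed_ker A).completeSpace_coe
  set N := (LinearMap.ker (A : K →ₗ[ℂ] H))
  have h1 : mk A x = kerPerpEquiv A (Nᗮ.orthogonalProjectionOnto x) := by
    apply incl_injective
    rw [incl_mk, incl_kerPerpEquiv]
    have h2 : x - Nᗮ.orthogonalProjectionOnto x ∈ N := by
      have := Submodule.sub_starProjection_mem_orthogonal (K := Nᗮ) x
      rwa [Submodule.orthogonal_orthogonal] at this
    have h3 : A (x - Nᗮ.orthogonalProjectionOnto x) = 0 := h2
    rwa [map_sub, sub_eq_zero] at h3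
  rw [h1]
  have h4 : ‖kerPerpEquiv A (Nᗮ.orthogonalProjectionOnto x)‖ =
      ‖Nᗮ.orthogonalProjectionOnto x‖ := by
    change ‖(kerPerpEquiv A).symm (kerPerpEquiv A _)‖ = _
    rw [LinearEquiv.symm_apply_apply]
  rw [h4]
  exact Submodule.norm_orthogonalProjectionOnto_apply_le _ x

/-- If `B A = A Y` then `B` restricts to a bounded operator on the range space of `A`. -/
theorem exists_restrict (B : H →L[ℂ] H) (Y : K →L[ℂ] K) (h : ∀ x, B (A x) = A (Y x)) :
    ∃ X : OperatorRange A →L[ℂ] OperatorRange A, ∀ f, incl A (X f) = B (incl A f) := by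
  have hB : ∀ f : OperatorRange A, ∃ x : K, mk A x = f ∧ B (incl A f) = A (Y x) ∧
      ‖x‖ = ‖f‖ := by
    intro f
    obtain ⟨x, rfl, hx⟩ := exists_mk_eq A f
    exact ⟨x, rfl, by rw [incl_mk, h], hx⟩
  have hr : ∀ f : OperatorRange A, (B : H →ₗ[ℂ] H).comp (incl A) f ∈
      LinearMap.range (A : K →ₗ[ℂ] H) := fun f => by
    obtain ⟨x, -, hx, -⟩ := hB f
    exact ⟨Y x, hx.symm⟩
  let X₀ : OperatorRange A →ₗ[ℂ] OperatorRange A :=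
    ((B : H →ₗ[ℂ] H).comp (incl A)).codRestrict (LinearMap.range (A : K →ₗ[ℂ] H)) hr
  have hX₀ : ∀ f, incl A (X₀ f) = B (incl A f) := fun f => rfl
  refine ⟨X₀.mkContinuous ‖Y‖ fun f => ?_, hX₀⟩
  obtain ⟨x, -, hx, hn⟩ := hB f
  have : X₀ f = mk A (Y x) := by
    apply incl_injective
    rw [hX₀, hx, incl_mk]
  rw [this, ← hn]
  exact (norm_mk_le A _).trans (Y.le_opNorm x)

end OperatorRange

/-! ### Defect operators and the inner product of a complementary space -/

section Defect

variable {K H : Type*} [NormedAddCommGroup K] [InnerProductSpace ℂ K] [CompleteSpace K]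
  [NormedAddCommGroup H] [InnerProductSpace ℂ H] [CompleteSpace H]

/-- The defect operator `√(I - T* T)`. -/
def defect (T : K →L[ℂ] H) : K →L[ℂ] K := CFC.sqrt (1 - T† ∘L T)

/-- The defect operator `√(I - T T*)`. -/
def codefect (T : K →L[ℂ] H) : H →L[ℂ] H := CFC.sqrt (1 - T ∘L T†)

theorem codefect_eq (T : K →L[ℂ] H) : codefect T = defect (T†) := by
  rw [codefect, defect, ContinuousLinearMap.adjoint_adjoint]

theorem norm_apply_le_of_contraction {T : K →L[ℂ] H} (hT : ‖T‖ ≤ 1) (x : K) : ‖T x‖ ≤ ‖x‖ :=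
  (T.le_of_opNorm_le hT x).trans_eq (one_mul _)

theorem re_inner_one_sub (T : K →L[ℂ] H) (x : K) :
    RCLike.re (inner ℂ ((1 - T† ∘L T) x) x) = ‖x‖ ^ 2 - ‖T x‖ ^ 2 := by
  rw [sub_apply, inner_sub_left, one_apply_eq_self,
    ContinuousLinearMap.comp_apply, ContinuousLinearMap.adjoint_inner_left,
    inner_self_eq_norm_sq_to_K, inner_self_eq_norm_sq_to_K]
  norm_cast

theorem one_sub_nonneg {T : K →L[ℂ] H} (hT : ‖T‖ ≤ 1) : 0 ≤ 1 - T† ∘L T := by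
  rw [ContinuousLinearMap.nonneg_iff_isPositive]
  refine ContinuousLinearMap.isPositive_def'.2 ⟨?_, fun x => ?_⟩
  · rw [ContinuousLinearMap.isSelfAdjoint_iff']
    simp [map_sub, ContinuousLinearMap.adjoint_comp, ContinuousLinearMap.one_def,
      ContinuousLinearMap.adjoint_id]
  · rw [ContinuousLinearMap.reApplyInnerSelf_apply, re_inner_one_sub, sub_nonneg]
    gcongr
    exact norm_apply_le_of_contraction hT x

theorem one_sub_le_one (T : K →L[ℂ] H) : 1 - T† ∘L T ≤ 1 := by
  rw [sub_le_self_iff, ContinuousLinearMap.nonneg_iff_isPositive]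
  exact ContinuousLinearMap.isPositive_adjoint_comp_self T

theorem defect_nonneg (T : K →L[ℂ] H) : 0 ≤ defect T := CFC.sqrt_nonneg _

theorem inner_defect_left (T : K →L[ℂ] H) (x y : K) :
    inner ℂ (defect T x) y = inner ℂ x (defect T y) := by
  have : IsSelfAdjoint (defect T) := IsSelfAdjoint.of_nonneg (defect_nonneg T)
  rw [ContinuousLinearMap.isSelfAdjoint_iff'] at this
  conv_lhs => rw [← this]
  exact ContinuousLinearMap.adjoint_inner_left _ _ _

theorem defect_defect {T : K →L[ℂ] H} (hT : ‖T‖ ≤ 1) (x : K) :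
    defect T (defect T x) = x - (T†) (T x) := by
  have : defect T * defect T = 1 - T† ∘L T := CFC.sqrt_mul_sqrt_self _ (one_sub_nonneg hT)
  exact DFunLike.congr_fun this x

theorem inner_defect_defect {T : K →L[ℂ] H} (hT : ‖T‖ ≤ 1) (x y : K) :
    inner ℂ (defect T x) (defect T y) = inner ℂ x y - inner ℂ (T x) (T y) := by
  rw [inner_defect_left, defect_defect hT, inner_sub_right,
    ContinuousLinearMap.adjoint_inner_right]

theorem norm_sq_defect {T : K →L[ℂ] H} (hT : ‖T‖ ≤ 1) (x : K) :
    ‖defect T x‖ ^ 2 = ‖x‖ ^ 2 - ‖T x‖ ^ 2 := by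
  have h := inner_defect_defect hT x x
  rw [inner_self_eq_norm_sq_to_K, inner_self_eq_norm_sq_to_K, inner_self_eq_norm_sq_to_K] at h
  exact_mod_cast h

theorem norm_adjoint_le_one {T : K →L[ℂ] H} (hT : ‖T‖ ≤ 1) : ‖T†‖ ≤ 1 := by
  rwa [LinearIsometryEquiv.norm_map]

/-- `T (I - T* T) = (I - T T*) T`, and intertwining passes to square roots. -/
theorem apply_defect {T : K →L[ℂ] H} (hT : ‖T‖ ≤ 1) (x : K) :
    T (defect T x) = codefect T (T x) := by
  have h1 := one_sub_nonneg (norm_adjoint_le_one hT)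
  have h2 := one_sub_le_one (T†)
  rw [ContinuousLinearMap.adjoint_adjoint] at h1 h2
  refine DFunLike.congr_fun (comp_cfcSqrt_of_intertwine (one_sub_nonneg hT) (one_sub_le_one T)
    h1 h2 ?_) x
  ext v
  simp

theorem adjoint_apply_codefect {T : K →L[ℂ] H} (hT : ‖T‖ ≤ 1) (x : H) :
    (T†) (codefect T x) = defect T ((T†) x) := by
  have := apply_defect (norm_adjoint_le_one hT) x
  rwa [← codefect_eq, codefect_eq (T†), ContinuousLinearMap.adjoint_adjoint] at this

theorem codefect_codefect {T : K →L[ℂ] H} (hT : ‖T‖ ≤ 1) (x : H) :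
    codefect T (codefect T x) = x - T ((T†) x) := by
  rw [codefect_eq, defect_defect (norm_adjoint_le_one hT), ContinuousLinearMap.adjoint_adjoint]

/-- An explicit preimage witnessing membership in the complementary space: `f - T T* f + T √(I - T*
T) z` collapses to `f`. -/
theorem codefect_of_adjoint_eq {T : K →L[ℂ] H} (hT : ‖T‖ ≤ 1) {f : H} {z : K}
    (h : (T†) f = defect T z) : codefect T (codefect T f + T z) = f := by
  rw [map_add, codefect_codefect hT, ← apply_defect hT, h, sub_add_cancel]

theorem exists_incl_eq_of_adjoint_eq {T : K →L[ℂ] H} (hT : ‖T‖ ≤ 1) {f : H} {z : K}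
    (h : (T†) f = defect T z) : ∃ F : ComplementarySpace T, OperatorRange.incl _ F = f :=
  ⟨OperatorRange.mk (codefect T) (codefect T f + T z), codefect_of_adjoint_eq hT h⟩

/-- The inner product of a complementary space: `⟨f₁, f₂⟩_T = ⟨f₁, f₂⟩ + ⟨z₁, z₂⟩`, where
`T* fᵢ = √(I - T* T) zᵢ` with `zᵢ ⟂ ker √(I - T* T)`. -/
theorem inner_complementarySpace {T : K →L[ℂ] H} (hT : ‖T‖ ≤ 1) {F₁ F₂ : ComplementarySpace T}
    {z₁ z₂ : K} (h₁ : (T†) (OperatorRange.incl _ F₁) = defect T z₁)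
    (h₂ : (T†) (OperatorRange.incl _ F₂) = defect T z₂)
    (hz₁ : ∀ v, defect T v = 0 → inner ℂ v z₁ = 0)
    (hz₂ : ∀ v, defect T v = 0 → inner ℂ v z₂ = 0) :
    inner ℂ F₁ F₂ = inner ℂ (OperatorRange.incl _ F₁) (OperatorRange.incl _ F₂) +
      inner ℂ z₁ z₂ := by
  -- The preimage `g = √(I - T T*) f + T z` is orthogonal to the kernel of `√(I - T T*)` and
  -- satisfies `T* g = z`. The formula is then `⟨g₁, g₂⟩ = ⟨√(I - T T*) g₁, √(I - T T*) g₂⟩ + ⟨T*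
  -- g₁, T* g₂⟩`.
  have key : ∀ (F : ComplementarySpace T) (z : K) (_ : (T†) (OperatorRange.incl _ F) = defect T z)
      (_ : ∀ v, defect T v = 0 → inner ℂ v z = 0), ∃ g : H,
      OperatorRange.mk (codefect T) g = F ∧ (∀ v, codefect T v = 0 → inner ℂ v g = 0) ∧
      codefect T g = OperatorRange.incl _ F ∧ (T†) g = z := by
    intro F z h hz
    refine ⟨codefect T (OperatorRange.incl _ F) + T z, ?_, fun v hv => ?_,
      codefect_of_adjoint_eq hT h, ?_⟩
    · apply OperatorRange.incl_injective
      exact codefect_of_adjoint_eq hT h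
    · rw [inner_add_right, codefect_eq, ← inner_defect_left, ← codefect_eq, hv, inner_zero_left,
        zero_add, ← ContinuousLinearMap.adjoint_inner_left]
      apply hz
      rw [← adjoint_apply_codefect hT, hv, map_zero]
    · rw [map_add, adjoint_apply_codefect hT, h, defect_defect hT, sub_add_cancel]
  obtain ⟨g₁, e₁, k₁, c₁, t₁⟩ := key F₁ z₁ h₁ hz₁
  obtain ⟨g₂, e₂, k₂, c₂, t₂⟩ := key F₂ z₂ h₂ hz₂
  have e : inner ℂ F₁ F₂ = inner ℂ g₁ g₂ := by
    rw [← e₁, ← e₂]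
    exact OperatorRange.inner_mk (codefect T) k₁ k₂
  rw [e, ← c₁, ← c₂, codefect_eq, inner_defect_defect (norm_adjoint_le_one hT), t₁, t₂,
    sub_add_cancel]

end Defect

variable {ι : Type*}

/-! ### Monomials and left shifts on Fock space -/

section FockSpace

open Classical in
/-- The monomial `z^ω` as a vector of Fock space. -/
def monomial (w : List ι) : Fock ι := lp.single 2 w (1 : ℂ)

theorem vacuum_eq_monomial : vacuum ι = monomial [] := rfl

theorem inner_monomial_left (w : List ι) (h : Fock ι) : inner ℂ (monomial w) h = h w := by
  classical
  rw [monomial, lp.inner_single_left]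
  simp

open Classical in
theorem monomial_apply (w v : List ι) : monomial w v = if v = w then 1 else 0 := by
  rw [monomial, lp.single_apply]
  simp [Pi.single_apply]

theorem vacuum_apply_nil : vacuum ι [] = 1 := by
  classical
  rw [vacuum_eq_monomial, monomial_apply, if_pos rfl]

theorem norm_coeff_le (h : Fock ι) (w : List ι) : ‖h w‖ ≤ ‖h‖ :=
  lp.norm_apply_le_norm (by norm_num) h w

theorem hasSum_monomial (h : Fock ι) : HasSum (fun w => h w • monomial w) h := by
  classical
  have := lp.hasSum_single (p := 2) (by norm_num) h
  refine this.congr_fun fun w => ?_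
  rw [monomial, ← lp.single_smul]
  simp

theorem eq_of_apply_monomial_eq {V : Type*} [NormedAddCommGroup V] [NormedSpace ℂ V]
    {A B : Fock ι →L[ℂ] V} (h : ∀ w, A (monomial w) = B (monomial w)) : A = B := by
  ext x
  have hA := (hasSum_monomial x).mapL A
  have hB := (hasSum_monomial x).mapL B
  simp only [map_smul, h] at hA hB
  exact hA.unique hB

theorem leftShift_nil (k : ι) (h : Fock ι) : leftShift k h [] = 0 := by
  classical
  rw [leftShift_apply]; simp [ncMul]

open Classical in
theorem leftShift_cons (k j : ι) (h : Fock ι) (v : List ι) :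
    leftShift k h (j :: v) = if j = k then h v else 0 := by
  have h1 : leftShift k h (j :: v) = inner ℂ (((leftShift k)†) (monomial (j :: v))) h := by
    rw [ContinuousLinearMap.adjoint_inner_left, inner_monomial_left]
  have h2 : ((leftShift k)†) (monomial (j :: v)) = if j = k then monomial v else 0 := by
    apply lp.ext; funext u
    rw [adjoint_leftShift_apply, monomial_apply]
    split_ifs with h1 h2 h3
    · rw [monomial_apply, if_pos (List.cons.inj h1).2]
    · exact absurd (List.cons.inj h1).1.symm h2
    · rw [monomial_apply, if_neg]
      rintro rfl; exact h1 (by rw [h3])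
    · rfl
  rw [h1, h2]
  split_ifs
  · rw [inner_monomial_left]
  · rw [inner_zero_left]

theorem leftShift_monomial (k : ι) (w : List ι) : leftShift k (monomial w) = monomial (k :: w) := by
  classical
  apply lp.ext; funext u
  cases u with
  | nil => rw [leftShift_nil, monomial_apply, if_neg (by simp)]
  | cons j v =>
    rw [leftShift_cons, monomial_apply, monomial_apply]
    by_cases h : j = k <;> simp [h]

open Classical in
theorem adjoint_leftShift_leftShift (k j : ι) (x : Fock ι) :
    ((leftShift k)†) (leftShift j x) = if k = j then x else 0 := by
  apply lp.ext; funext v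
  rw [adjoint_leftShift_apply, leftShift_cons]
  split_ifs <;> rfl

open Classical in
theorem inner_leftShift (k j : ι) (x y : Fock ι) :
    inner ℂ (leftShift k x) (leftShift j y) = if k = j then inner ℂ x y else 0 := by
  rw [← ContinuousLinearMap.adjoint_inner_right, adjoint_leftShift_leftShift]
  split_ifs
  · rfl
  · rw [inner_zero_right]

/-- Left multiplication by the monomial `z^ω`. -/
def wordShift (w : List ι) : Fock ι →L[ℂ] Fock ι := (w.map leftShift).prod

theorem wordShift_nil (x : Fock ι) : wordShift [] x = x := rfl

theorem wordShift_cons (k : ι) (w : List ι) (x : Fock ι) :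
    wordShift (k :: w) x = leftShift k (wordShift w x) := by
  rw [wordShift, List.map_cons, List.prod_cons]; rfl

theorem wordShift_append (v w : List ι) (x : Fock ι) :
    wordShift (v ++ w) x = wordShift v (wordShift w x) := by
  induction v with
  | nil => rfl
  | cons k v ih => rw [List.cons_append, wordShift_cons, wordShift_cons, ih]

theorem wordShift_monomial (w v : List ι) : wordShift w (monomial v) = monomial (w ++ v) := by
  induction w with
  | nil => rfl
  | cons k w ih => rw [wordShift_cons, ih, leftShift_monomial, List.cons_append]

theorem wordShift_vacuum (w : List ι) : wordShift w (vacuum ι) = monomial w := by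
  rw [vacuum_eq_monomial, wordShift_monomial, List.append_nil]

theorem wordShift_apply_nil {w : List ι} (hw : w ≠ []) (x : Fock ι) : wordShift w x [] = 0 := by
  cases w with
  | nil => exact absurd rfl hw
  | cons k w => rw [wordShift_cons, leftShift_nil]

/-- Summing over the first letter of a word. -/
theorem hasSum_norm_sq_adjoint_leftShift (h : Fock ι) :
    HasSum (fun k => ‖((leftShift k)†) h‖ ^ 2) (‖h‖ ^ 2 - ‖h []‖ ^ 2) := by
  classical
  have key : ∀ g : Fock ι, HasSum (fun w => ‖g w‖ ^ 2) (‖g‖ ^ 2) := fun g => by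
    have := lp.hasSum_norm (p := 2) (by norm_num) g
    simpa using this
  have h0 := key h
  have h1 : HasSum (fun w : List ι => if w = [] then ‖h []‖ ^ 2 else 0) (‖h []‖ ^ 2) :=
    hasSum_ite_eq _ _
  have h2 := h0.sub h1
  let φ : (Σ _ : ι, List ι) → List ι := fun p => p.1 :: p.2
  have hφ : Function.Injective φ := by
    rintro ⟨k, v⟩ ⟨j, w⟩ hh
    obtain ⟨rfl, rfl⟩ := List.cons.inj hh
    rfl
  rw [← hφ.hasSum_iff] at h2
  · refine h2.sigma fun k => ?_
    have := key (((leftShift k)†) h)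
    simpa [φ, adjoint_leftShift_apply] using this
  · intro w hw
    cases w with
    | nil => simp
    | cons k v => exact absurd ⟨⟨k, v⟩, rfl⟩ hw

end FockSpace

/-! ### Operators commuting with the left shifts -/

section Commuting

/-- Operators commuting with the left shifts, i.e. right multiplication operators. -/
def CommutesWithShifts (S : Fock ι →L[ℂ] Fock ι) : Prop :=
  ∀ k x, S (leftShift k x) = leftShift k (S x)

namespace CommutesWithShifts

variable {S : Fock ι →L[ℂ] Fock ι}

theorem apply_wordShift (hS : CommutesWithShifts S) (w : List ι) (x : Fock ι) :
    S (wordShift w x) = wordShift w (S x) := by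
  induction w with
  | nil => rfl
  | cons k w ih => rw [wordShift_cons, hS, ih, wordShift_cons]

theorem adjoint_apply (hS : CommutesWithShifts S) (k : ι) (x : Fock ι) :
    (S†) (((leftShift k)†) x) = ((leftShift k)†) ((S†) x) := by
  have : S ∘L leftShift k = leftShift k ∘L S := by ext1 x; exact hS k x
  have h2 := congrArg ContinuousLinearMap.adjoint this
  rw [ContinuousLinearMap.adjoint_comp, ContinuousLinearMap.adjoint_comp] at h2
  exact (DFunLike.congr_fun h2 x).symm

theorem adjoint_apply_wordShift (hS : CommutesWithShifts S) (w : List ι) (x : Fock ι) :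
    (S†) (((wordShift w)†) x) = ((wordShift w)†) ((S†) x) := by
  have : S ∘L wordShift w = wordShift w ∘L S := by ext1 x; exact hS.apply_wordShift w x
  have h2 := congrArg ContinuousLinearMap.adjoint this
  rw [ContinuousLinearMap.adjoint_comp, ContinuousLinearMap.adjoint_comp] at h2
  exact (DFunLike.congr_fun h2 x).symm

theorem sub {S' : Fock ι →L[ℂ] Fock ι} (hS : CommutesWithShifts S) (hS' : CommutesWithShifts S') :
    CommutesWithShifts (S - S') := fun k x => by
  rw [sub_apply, sub_apply, hS, hS', map_sub]

theorem comp {S' : Fock ι →L[ℂ] Fock ι} (hS : CommutesWithShifts S)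
    (hS' : CommutesWithShifts S') : CommutesWithShifts (S ∘L S') := fun k x => by
  rw [ContinuousLinearMap.comp_apply, hS', hS]; rfl

open Classical in
theorem inner_leftShift (hS : CommutesWithShifts S) (k : ι) (j : ι) (x y : Fock ι) :
    inner ℂ (S (leftShift k x)) (S (leftShift j y)) = if k = j then inner ℂ (S x) (S y) else 0 := by
  rw [hS, hS, FreeSarason.inner_leftShift]

end CommutesWithShifts

open Classical in
theorem wordShift_apply (v w : List ι) (g : Fock ι) :
    wordShift v g w = if v <+: w then g (w.drop v.length) else 0 := by
  induction v generalizing w with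
  | nil => simp [wordShift_nil]
  | cons k v ih =>
    rw [wordShift_cons]
    cases w with
    | nil => rw [leftShift_nil]; simp
    | cons j w =>
      rw [leftShift_cons, ih]
      by_cases h : j = k <;> simp [h, List.cons_prefix_cons]
      intro hh; exact absurd hh.symm h

theorem ncMul_monomial (v w : List ι) (g : Fock ι) :
    ncMul (monomial v) g w = wordShift v g w := by
  classical
  rw [wordShift_apply, ncMul]
  split_ifs with h
  · rw [Finset.sum_eq_single v.length]
    · rw [monomial_apply, if_pos (List.prefix_iff_eq_take.1 h).symm, one_mul]
    · intro n hn hne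
      rw [monomial_apply, if_neg, zero_mul]
      intro hh
      apply hne
      rw [← hh, List.length_take]
      rw [Finset.mem_range] at hn
      omega
    · intro hh
      exact absurd (Finset.mem_range.2 (Nat.lt_succ_of_le h.length_le)) hh
  · refine Finset.sum_eq_zero fun n _ => ?_
    rw [monomial_apply, if_neg, zero_mul]
    rintro rfl
    exact h (List.take_prefix _ _)

/-- An operator commuting with the left shifts is right multiplication by the image of `1`. -/
theorem CommutesWithShifts.apply_eq_ncMul {S : Fock ι →L[ℂ] Fock ι} (hS : CommutesWithShifts S)
    (h : Fock ι) (w : List ι) : S h w = ncMul h (S (vacuum ι)) w := by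
  let ev : List ι → Fock ι →L[ℂ] ℂ := fun v => innerSL ℂ (monomial v)
  have hev : ∀ v x, ev v x = x v := fun v x => inner_monomial_left v x
  let A : Fock ι →L[ℂ] ℂ := ev w ∘L S
  let B : Fock ι →L[ℂ] ℂ := ∑ n ∈ Finset.range (w.length + 1),
    S (vacuum ι) (w.drop n) • ev (w.take n)
  have hB : ∀ x : Fock ι, B x = ncMul x (S (vacuum ι)) w := fun x => by
    simp only [B, sum_apply, smul_apply, hev, ncMul, smul_eq_mul]
    exact Finset.sum_congr rfl fun n _ => mul_comm _ _
  have hAB : A = B := by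
    apply eq_of_apply_monomial_eq
    intro v
    rw [hB, ncMul_monomial, ← hS.apply_wordShift, wordShift_vacuum]
    exact hev _ _
  rw [← hB, ← hAB]
  exact (hev _ _).symm

/-- A non-zero right multiplication operator is bounded below on the series with constant
coefficient `1`. -/
theorem CommutesWithShifts.exists_le_norm {S : Fock ι →L[ℂ] Fock ι} (hS : CommutesWithShifts S)
    (h0 : S ≠ 0) : ∃ ε > 0, ∀ x : Fock ι, x [] = 1 → ε ≤ ‖S x‖ := by
  have h1 : ∃ n : ℕ, ∃ w : List ι, w.length = n ∧ S (vacuum ι) w ≠ 0 := by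
    by_contra! hh
    apply h0
    ext x w
    rw [hS.apply_eq_ncMul, ncMul]
    exact Finset.sum_eq_zero fun n _ => by rw [hh _ _ rfl, mul_zero]
  classical
  -- A word of least length with non-zero coefficient in `S 1`: when `x(0) = 1`, the only surviving
  -- term of `x · (S 1)` at `w` is the coefficient of `S 1` itself.
  obtain ⟨w, hw, hne⟩ := Nat.find_spec h1
  have hmin : ∀ v : List ι, v.length < w.length → S (vacuum ι) v = 0 := fun v hv => by
    by_contra hh
    exact Nat.find_min h1 (hw ▸ hv) ⟨v, rfl, hh⟩
  refine ⟨‖S (vacuum ι) w‖, norm_pos_iff.2 hne, fun x hx => ?_⟩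
  have : S x w = S (vacuum ι) w := by
    rw [hS.apply_eq_ncMul, ncMul, Finset.sum_eq_single 0]
    · simp [hx]
    · intro n hn hn0
      rw [hmin, mul_zero]
      rw [Finset.mem_range] at hn
      rw [List.length_drop]
      omega
    · intro hh; simp at hh
  rw [← this]
  exact norm_coeff_le _ _

end Commuting

/-! ### Multipliers as operators, and contractive columns -/

section Multipliers

theorem flip_apply (h : Fock ι) (w : List ι) : flip h w = h w.reverse := rfl

theorem flip_flip (h : Fock ι) : flip (flip h) = h := by
  apply lp.ext; funext w
  rw [flip_apply, flip_apply, List.reverse_reverse]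

theorem norm_flip_le (h : Fock ι) : ‖flip h‖ ≤ ‖h‖ := by
  have : ‖(flip : Fock ι →L[ℂ] Fock ι)‖ ≤ 1 := by
    unfold flip compOp
    exact LinearMap.mkContinuous_norm_le _ zero_le_one _
  exact (ContinuousLinearMap.le_of_opNorm_le _ this h).trans_eq (one_mul _)

theorem norm_flip (h : Fock ι) : ‖flip h‖ = ‖h‖ :=
  (norm_flip_le h).antisymm (by conv_lhs => rw [← flip_flip h]
                                exact norm_flip_le _)

namespace Hinf

theorem opR_eq (F : Hinf ι) (h : Fock ι) : F.opR h = flip (F.opL (flip h)) := rfl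

theorem opL_eq (F : Hinf ι) (h : Fock ι) : F.opL h = flip (F.opR (flip h)) := by
  rw [opR_eq, flip_flip, flip_flip]

theorem coeff_eq (F : Hinf ι) (w : List ι) : F.coeff w = F.opR (vacuum ι) w.reverse := by
  have := F.transpose_apply w.reverse
  rw [List.reverse_reverse] at this
  exact this.symm

theorem ext_coeff {F G : Hinf ι} (h : F.coeff = G.coeff) : F = G := by
  obtain ⟨c, A, hA⟩ := F
  obtain ⟨c', B, hB⟩ := G
  obtain rfl : c = c' := h
  have : A = B := by
    ext x w
    rw [hA, hB]
  subst this
  rfl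

theorem commutes_opR (F : Hinf ι) : CommutesWithShifts F.opR := by
  classical
  intro k x
  apply lp.ext; funext w
  rw [opR_apply]
  cases w with
  | nil => rw [leftShift_nil]; simp [ncMul, leftShift_nil]
  | cons j v =>
    rw [leftShift_cons, opR_apply, ncMul, List.length_cons, Finset.sum_range_succ']
    simp only [List.take_succ_cons, List.drop_succ_cons, leftShift_cons, List.take_zero,
      leftShift_nil, zero_mul, add_zero]
    split_ifs
    · rfl
    · simp

/-- Together with `commutes_opR` this identifies multipliers with bounded operators commuting with
the left shifts, so multipliers can be constructed and compared as operators. -/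
theorem exists_opR_eq {S : Fock ι →L[ℂ] Fock ι} (hS : CommutesWithShifts S) :
    ∃ F : Hinf ι, F.opR = S := by
  refine ⟨⟨fun w => S (vacuum ι) w.reverse, flip ∘L S ∘L flip, fun h w => ?_⟩, ?_⟩
  · change S (flip h) w.reverse = _
    rw [hS.apply_eq_ncMul, ncMul, ncMul, ← Finset.sum_range_reflect, List.length_reverse]
    refine Finset.sum_congr rfl fun n hn => ?_
    rw [Finset.mem_range] at hn
    have e : w.length + 1 - 1 - n = w.length - n := by omega
    have e2 : w.length - (w.length - n) = n := by omega
    rw [e, List.drop_reverse, List.take_reverse, flip_apply, List.reverse_reverse, mul_comm, e2]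
  · ext1 x
    rw [opR_eq]
    change flip (flip (S (flip (flip x)))) = _
    rw [flip_flip, flip_flip]

theorem coeff_eq_zero_of_opR_eq_zero {F : Hinf ι} (h : F.opR = 0) (w : List ι) :
    F.coeff w = 0 := by
  rw [coeff_eq, h]; rfl

end Hinf

variable {κ : Type*} [Fintype κ]

theorem norm_sq_colR (c : κ → Hinf ι) (h : Fock ι) :
    ‖colR c h‖ ^ 2 = ∑ j, ‖(c j).opR h‖ ^ 2 := by
  rw [PiLp.norm_sq_eq_of_L2]; rfl

theorem norm_sq_colL_flip (c : κ → Hinf ι) (h : Fock ι) :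
    ‖colL c (flip h)‖ ^ 2 = ∑ j, ‖(c j).opR h‖ ^ 2 := by
  rw [PiLp.norm_sq_eq_of_L2]
  refine Finset.sum_congr rfl fun j _ => ?_
  rw [Hinf.opR_eq, norm_flip]; rfl

/-- Left and right multiplication are conjugate under the isometric letter reversal, so
contractivity can be tested on the right. -/
theorem norm_colL_le_one_iff (c : κ → Hinf ι) :
    ‖colL c‖ ≤ 1 ↔ ∀ h, ∑ j, ‖(c j).opR h‖ ^ 2 ≤ ‖h‖ ^ 2 := by
  rw [ContinuousLinearMap.opNorm_le_iff zero_le_one]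
  constructor
  · intro H h
    rw [← norm_sq_colL_flip, ← norm_flip h]
    have := H (flip h)
    rw [one_mul] at this
    gcongr
  · intro H h
    have := H (flip h)
    rw [← norm_sq_colL_flip, flip_flip, norm_flip] at this
    rw [one_mul]
    exact (sq_le_sq₀ (norm_nonneg _) (norm_nonneg _)).1 this

theorem norm_colR_le_one_iff (c : κ → Hinf ι) :
    ‖colR c‖ ≤ 1 ↔ ∀ h, ∑ j, ‖(c j).opR h‖ ^ 2 ≤ ‖h‖ ^ 2 := by
  rw [ContinuousLinearMap.opNorm_le_iff zero_le_one]
  refine forall_congr' fun h => ?_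
  rw [← norm_sq_colR, one_mul, sq_le_sq₀ (norm_nonneg _) (norm_nonneg _)]

theorem norm_opL_le_one_iff (F : Hinf ι) : ‖F.opL‖ ≤ 1 ↔ ∀ h, ‖F.opR h‖ ≤ ‖h‖ := by
  rw [ContinuousLinearMap.opNorm_le_iff zero_le_one]
  constructor
  · intro H h
    rw [Hinf.opR_eq, norm_flip]
    simpa [norm_flip] using H (flip h)
  · intro H h
    rw [Hinf.opL_eq, norm_flip, one_mul]
    simpa [norm_flip] using H (flip h)

end Multipliers

/-! ### Free polynomials without constant term -/

section FreePolynomials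

theorem isFreePolynomial_monomial (w : List ι) : IsFreePolynomial (monomial w) := by
  classical
  refine (Set.finite_singleton w).subset fun v hv => ?_
  by_contra hh
  exact hv ((monomial_apply w v).trans (if_neg hh))

theorem isFreePolynomial_zero : IsFreePolynomial (0 : Fock ι) := by
  simp [IsFreePolynomial]

theorem IsFreePolynomial.add {p q : Fock ι} (hp : IsFreePolynomial p) (hq : IsFreePolynomial q) :
    IsFreePolynomial (p + q) := by
  refine (hp.union hq).subset fun v hv => ?_
  by_contra hh
  simp only [Set.mem_union, Set.mem_ofPred_eq, not_or, not_not] at hh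
  apply hv
  rw [lp.coeFn_add, Pi.add_apply, hh.1, hh.2, add_zero]

theorem IsFreePolynomial.smul {p : Fock ι} (hp : IsFreePolynomial p) (c : ℂ) :
    IsFreePolynomial (c • p) := by
  refine hp.subset fun v hv => ?_
  by_contra hh
  simp only [Set.mem_ofPred_eq, not_not] at hh
  apply hv
  rw [lp.coeFn_smul, Pi.smul_apply, hh, smul_zero]

/-- The free polynomials with vanishing constant coefficient. -/
def augmentation (ι : Type*) : Submodule ℂ (Fock ι) where
  carrier := {p | IsFreePolynomial p ∧ p [] = 0}
  add_mem' := fun ⟨hp, hp0⟩ ⟨hq, hq0⟩ => ⟨hp.add hq, by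
    rw [lp.coeFn_add, Pi.add_apply, hp0, hq0, add_zero]⟩
  zero_mem' := ⟨isFreePolynomial_zero, rfl⟩
  smul_mem' := fun c _ ⟨hp, hp0⟩ => ⟨hp.smul c, by
    rw [lp.coeFn_smul, Pi.smul_apply, hp0, smul_zero]⟩

theorem mem_closure_augmentation {h : Fock ι} (h0 : h [] = 0) :
    h ∈ closure (augmentation ι : Set (Fock ι)) := by
  refine mem_closure_of_tendsto (hasSum_monomial h) (Filter.Eventually.of_forall fun s => ?_)
  refine Submodule.sum_mem _ fun w _ => ?_
  by_cases hw : w = []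
  · rw [hw, h0, zero_smul]; exact Submodule.zero_mem _
  · refine Submodule.smul_mem _ _ ⟨isFreePolynomial_monomial w, ?_⟩
    classical
    rw [monomial_apply, if_neg (Ne.symm hw)]

theorem exists_sum_leftShift_eq {p : Fock ι} (hp : p ∈ augmentation ι) :
    ∃ s : Finset ι, p = ∑ k ∈ s, leftShift k (((leftShift k)†) p) := by
  classical
  obtain ⟨hp, hp0⟩ := hp
  -- The first letters of the words in the support of `p`: a finite set even when there are
  -- infinitely many letters.
  refine ⟨(hp.toFinset.toList.filterMap List.head?).toFinset, ?_⟩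
  apply lp.ext; funext w
  rw [lp.coeFn_sum, Finset.sum_apply]
  cases w with
  | nil => rw [hp0]; exact (Finset.sum_eq_zero fun k _ => leftShift_nil _ _).symm
  | cons j v =>
    simp only [leftShift_cons, adjoint_leftShift_apply]
    by_cases h : p (j :: v) = 0
    · rw [h]; symm
      refine Finset.sum_eq_zero fun k _ => ?_
      split_ifs with hjk
      · rw [← hjk, h]
      · rfl
    · rw [Finset.sum_ite_eq, if_pos]
      simp only [List.mem_toFinset, List.mem_filterMap, Finset.mem_toList]
      exact ⟨j :: v, hp.mem_toFinset.2 h, rfl⟩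

end FreePolynomials

/-! ### Szegő theory and the outer factor of a Toeplitz operator -/

open Filter Topology

open Classical in
/-- `D` is self-adjoint and `D²` is a Toeplitz operator for the left shifts,
`L_k* D² L_j = δ_{kj} D²`. -/
structure IsToeplitzRoot (D : Fock ι →L[ℂ] Fock ι) : Prop where
  inner_left : ∀ x y, inner ℂ (D x) y = inner ℂ x (D y)
  inner_shift : ∀ k j x y, inner ℂ (D (leftShift k x)) (D (leftShift j y)) =
    if k = j then inner ℂ (D x) (D y) else 0

namespace IsToeplitzRoot

variable {D : Fock ι →L[ℂ] Fock ι}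

theorem norm_apply_leftShift (hD : IsToeplitzRoot D) (k : ι) (x : Fock ι) : ‖D (leftShift k x)‖ = ‖D x‖ := by
  have h := hD.inner_shift k k x x
  rw [if_pos rfl, inner_self_eq_norm_sq_to_K, inner_self_eq_norm_sq_to_K] at h
  have h' : ‖D (leftShift k x)‖ ^ 2 = ‖D x‖ ^ 2 := by exact_mod_cast h
  exact (sq_eq_sq₀ (norm_nonneg _) (norm_nonneg _)).1 h'

theorem norm_apply_wordShift (hD : IsToeplitzRoot D) (w : List ι) (x : Fock ι) : ‖D (wordShift w x)‖ = ‖D x‖ := by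
  induction w with
  | nil => rfl
  | cons k w ih => rw [wordShift_cons, hD.norm_apply_leftShift, ih]

theorem exists_lift (hD : IsToeplitzRoot D) (w : List ι) : ∃ W : Fock ι →L[ℂ] Fock ι,
    (∀ x, W (D x) = D (wordShift w x)) ∧ ∀ v, D v = 0 → W v = 0 := by
  obtain ⟨W, -, h2, h3⟩ := exists_contraction_comp_eq (D ∘L wordShift w) D
    fun x => (hD.norm_apply_wordShift w x).le
  exact ⟨W, h2, fun v hv => h3 v fun x => by rw [hD.inner_left, hv, inner_zero_right]⟩

/-- The partial isometry `D x ↦ D z^ω x`. -/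
def lift (hD : IsToeplitzRoot D) (w : List ι) : Fock ι →L[ℂ] Fock ι := (hD.exists_lift w).choose

theorem lift_apply (hD : IsToeplitzRoot D) (w : List ι) (x : Fock ι) : hD.lift w (D x) = D (wordShift w x) :=
  (hD.exists_lift w).choose_spec.1 x

theorem lift_of_apply_eq_zero (hD : IsToeplitzRoot D) (w : List ι) {v : Fock ι} (hv : D v = 0) : hD.lift w v = 0 :=
  (hD.exists_lift w).choose_spec.2 v hv

/-- This solves `D z = (z^ω)* D y` explicitly, which is how backward shifts are placed in the
complementary space. -/
theorem apply_adjoint_lift (hD : IsToeplitzRoot D) (w : List ι) (y : Fock ι) :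
    D (((hD.lift w)†) y) = ((wordShift w)†) (D y) := by
  refine ext_inner_left ℂ fun x => ?_
  rw [← hD.inner_left, ContinuousLinearMap.adjoint_inner_right, hD.lift_apply,
    ContinuousLinearMap.adjoint_inner_right, hD.inner_left]

theorem inner_adjoint_lift (hD : IsToeplitzRoot D) (w : List ι) {v : Fock ι} (y : Fock ι) (hv : D v = 0) :
    inner ℂ v (((hD.lift w)†) y) = 0 := by
  rw [ContinuousLinearMap.adjoint_inner_right, hD.lift_of_apply_eq_zero w hv, inner_zero_left]

/-- The closed span of the vectors `D p`, `p` a free polynomial with `p(0) = 0`. -/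
def past (D : Fock ι →L[ℂ] Fock ι) : Submodule ℂ (Fock ι) :=
  ((augmentation ι).map (D : Fock ι →ₗ[ℂ] Fock ι)).topologicalClosure

theorem coe_past : (past D : Set (Fock ι)) = closure (D '' (augmentation ι : Set (Fock ι))) := by
  rw [past, Submodule.topologicalClosure_coe, Submodule.map_coe]; rfl

instance (D : Fock ι →L[ℂ] Fock ι) : CompleteSpace (past D) :=
  (Submodule.isClosed_topologicalClosure _).completeSpace_coe

/-- The component of `D 1` orthogonal to all `D p`, `p` a free polynomial with `p(0) = 0`. -/
def residual (D : Fock ι →L[ℂ] Fock ι) : Fock ι :=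
  D (vacuum ι) - (past D).starProjection (D (vacuum ι))

theorem inner_residual_eq_zero {h : Fock ι} (h0 : h [] = 0) : inner ℂ (residual D) (D h) = 0 := by
  have h1 : D h ∈ past D := by
    have : D h ∈ closure (D '' (augmentation ι : Set (Fock ι))) :=
      image_closure_subset_closure_image D.continuous ⟨h, mem_closure_augmentation h0, rfl⟩
    change D h ∈ (past D : Set (Fock ι))
    rwa [coe_past]
  exact Submodule.inner_left_of_mem_orthogonal h1
    (Submodule.sub_starProjection_mem_orthogonal _)

theorem inner_residual_vacuum :
    inner ℂ (residual D) (D (vacuum ι)) = ((‖residual D‖ ^ 2 : ℝ) : ℂ) := by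
  have h1 : D (vacuum ι) = residual D + (past D).starProjection (D (vacuum ι)) := by
    rw [residual, sub_add_cancel]
  have h2 : inner ℂ (residual D) ((past D).starProjection (D (vacuum ι))) = 0 :=
    Submodule.inner_left_of_mem_orthogonal (Submodule.starProjection_apply_mem _ _)
      (Submodule.sub_starProjection_mem_orthogonal _)
  conv_lhs => rw [h1]
  rw [inner_add_right, h2, add_zero, inner_self_eq_norm_sq_to_K]
  norm_cast

/-- `h - h(0) 1` has no constant term and is a limit of polynomials without constant term, so its
image under `D` is orthogonal to the residual. -/
theorem inner_residual_apply (h : Fock ι) :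
    inner ℂ (residual D) (D h) = h [] * ((‖residual D‖ ^ 2 : ℝ) : ℂ) := by
  have h1 : (h - h [] • vacuum ι) [] = 0 := by
    rw [lp.coeFn_sub, Pi.sub_apply, lp.coeFn_smul, Pi.smul_apply, vacuum_apply_nil]
    simp
  have h2 := inner_residual_eq_zero (D := D) h1
  rw [map_sub, map_smul, inner_sub_right, inner_smul_right, inner_residual_vacuum] at h2
  exact sub_eq_zero.1 h2

/-- Cauchy–Schwarz applied to `⟨u, D x⟩ = ‖u‖²`, where `u` is the residual. -/
theorem norm_residual_le {x : Fock ι} (hx : x [] = 1) : ‖residual D‖ ≤ ‖D x‖ := by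
  have h := inner_residual_apply (D := D) x
  rw [hx, one_mul] at h
  have h2 := norm_inner_le_norm (𝕜 := ℂ) (residual D) (D x)
  rw [h, Complex.norm_real, Real.norm_of_nonneg (by positivity), sq] at h2
  by_cases h0 : ‖residual D‖ = 0
  · rw [h0]; positivity
  · exact le_of_mul_le_mul_left h2 (lt_of_le_of_ne (norm_nonneg _) (Ne.symm h0))

/-- The residual is accessible as a limit of vectors `D x` with `x(0) = 1`; this is how identities
on the range of `D` are transferred to it. -/
theorem exists_tendsto_residual : ∃ x : ℕ → Fock ι, (∀ n, vacuum ι - x n ∈ augmentation ι) ∧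
    Tendsto (fun n => D (x n)) atTop (𝓝 (residual D)) := by
  have h1 : (past D).starProjection (D (vacuum ι)) ∈ (past D : Set (Fock ι)) :=
    Submodule.starProjection_apply_mem _ _
  rw [coe_past, mem_closure_iff_seq_limit] at h1
  obtain ⟨y, hy, hlim⟩ := h1
  choose p hp hpy using hy
  refine ⟨fun n => vacuum ι - p n, fun n => ?_, ?_⟩
  · rw [sub_sub_cancel]; exact hp n
  · have : (fun n => D (vacuum ι - p n)) = fun n => D (vacuum ι) - y n := by
      funext n
      rw [map_sub, ← hpy n]
    rw [this]
    exact tendsto_const_nhds.sub hlim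

theorem apply_nil_eq_one {x : Fock ι} (hx : vacuum ι - x ∈ augmentation ι) : x [] = 1 := by
  have := hx.2
  rw [lp.coeFn_sub, Pi.sub_apply, vacuum_apply_nil, sub_eq_zero] at this
  exact this.symm

theorem isGLB_norm_residual_sq : IsGLB {r : ℝ | ∃ p : Fock ι, IsFreePolynomial p ∧ p [] = 0 ∧
    r = ‖D (vacuum ι - p)‖ ^ 2} (‖residual D‖ ^ 2) := by
  constructor
  · rintro r ⟨p, -, hp0, rfl⟩
    have := norm_residual_le (D := D) (x := vacuum ι - p) (by
      rw [lp.coeFn_sub, Pi.sub_apply, vacuum_apply_nil, hp0, sub_zero])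
    gcongr
  · intro r hr
    obtain ⟨x, hx, hlim⟩ := exists_tendsto_residual (D := D)
    refine ge_of_tendsto' (hlim.norm.pow 2) fun n => hr ⟨vacuum ι - x n, (hx n).1, (hx n).2, ?_⟩
    rw [sub_sub_cancel]

/-- The functional `h ↦ ⟨u, D h⟩` sees only the constant coefficient of `h`. -/
theorem apply_residual (hD : IsToeplitzRoot D) : D (residual D) = ((‖residual D‖ ^ 2 : ℝ) : ℂ) • vacuum ι := by
  refine ext_inner_right ℂ fun h => ?_
  rw [hD.inner_left, inner_residual_apply, inner_smul_left, vacuum_eq_monomial,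
    inner_monomial_left, Complex.conj_ofReal, mul_comm]

theorem inner_residual_of_apply_eq_zero (hD : IsToeplitzRoot D) {v : Fock ι} (hv : D v = 0) :
    inner ℂ v (residual D) = 0 := by
  obtain ⟨x, hx, hlim⟩ := exists_tendsto_residual (D := D)
  have h1 : Tendsto (fun n => inner ℂ v (D (x n))) atTop (𝓝 (inner ℂ v (residual D))) :=
    tendsto_const_nhds.inner hlim
  have h2 : (fun n => inner ℂ v (D (x n))) = fun _ => (0 : ℂ) := by
    funext n; rw [← hD.inner_left, hv, inner_zero_left]
  rw [h2] at h1
  exact tendsto_nhds_unique h1 tendsto_const_nhds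

theorem tendsto_lift_residual (hD : IsToeplitzRoot D) {x : ℕ → Fock ι}
    (hlim : Tendsto (fun n => D (x n)) atTop (𝓝 (residual D))) (w : List ι) :
    Tendsto (fun n => D (wordShift w (x n))) atTop (𝓝 (hD.lift w (residual D))) := by
  have := ((hD.lift w).continuous.tendsto _).comp hlim
  simpa only [Function.comp_def, hD.lift_apply] using this

theorem lift_nil_residual (hD : IsToeplitzRoot D) : hD.lift [] (residual D) = residual D := by
  obtain ⟨x, -, hlim⟩ := exists_tendsto_residual (D := D)
  exact tendsto_nhds_unique (hD.tendsto_lift_residual hlim []) hlim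

open Classical in
theorem inner_apply_leftShift_lift (hD : IsToeplitzRoot D) (k j : ι) (h : Fock ι) (v : List ι) :
    inner ℂ (D (leftShift k h)) (hD.lift (j :: v) (residual D)) =
      if k = j then inner ℂ (D h) (hD.lift v (residual D)) else 0 := by
  obtain ⟨x, -, hlim⟩ := exists_tendsto_residual (D := D)
  have h1 := (tendsto_const_nhds (x := D (leftShift k h))).inner (𝕜 := ℂ)
    (hD.tendsto_lift_residual hlim (j :: v))
  have h2 := (tendsto_const_nhds (x := D h)).inner (𝕜 := ℂ) (hD.tendsto_lift_residual hlim v)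
  simp only [wordShift_cons, hD.inner_shift] at h1
  split_ifs at h1 ⊢
  · exact tendsto_nhds_unique h1 h2
  · exact tendsto_nhds_unique h1 tendsto_const_nhds

open Classical in
-- The residual is a wandering vector. The Toeplitz identity strips equal first letters and gives
-- `0` for distinct ones. If just one word is exhausted, what remains is a limit of `⟨u, D (z^v
-- x_n)⟩` with `v ≠ ∅`, and `z^v x_n` has no constant term.
theorem inner_lift_lift (hD : IsToeplitzRoot D) (w v : List ι) :
    inner ℂ (hD.lift w (residual D)) (hD.lift v (residual D)) =
      if w = v then ((‖residual D‖ ^ 2 : ℝ) : ℂ) else 0 := by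
  obtain ⟨x, -, hlim⟩ := exists_tendsto_residual (D := D)
  have hzero : ∀ j v, inner ℂ (residual D) (hD.lift (j :: v) (residual D)) = 0 := by
    intro j v
    have h1 := (tendsto_const_nhds (x := residual D)).inner (𝕜 := ℂ)
      (hD.tendsto_lift_residual hlim (j :: v))
    have h2 : ∀ n, inner ℂ (residual D) (D (wordShift (j :: v) (x n))) = 0 := fun n =>
      inner_residual_eq_zero (wordShift_apply_nil (by simp) _)
    simp only [h2] at h1
    exact tendsto_nhds_unique h1 tendsto_const_nhds
  induction w generalizing v with
  | nil =>
    cases v with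
    | nil =>
      rw [if_pos rfl, lift_nil_residual, inner_self_eq_norm_sq_to_K]
      norm_cast
    | cons j v => rw [if_neg (by simp), lift_nil_residual, hzero]
  | cons k w ih =>
    cases v with
    | nil =>
      rw [if_neg (by simp), lift_nil_residual, ← inner_conj_symm, hzero, map_zero]
    | cons j v =>
      have h1 := (hD.tendsto_lift_residual hlim (k :: w)).inner (𝕜 := ℂ)
        (tendsto_const_nhds (x := hD.lift (j :: v) (residual D)))
      have h2 := (hD.tendsto_lift_residual hlim w).inner (𝕜 := ℂ)
        (tendsto_const_nhds (x := hD.lift v (residual D)))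
      simp only [wordShift_cons, hD.inner_apply_leftShift_lift] at h1
      have h3 : inner ℂ (hD.lift (k :: w) (residual D)) (hD.lift (j :: v) (residual D)) =
          if k = j then inner ℂ (hD.lift w (residual D)) (hD.lift v (residual D)) else 0 := by
        split_ifs at h1 ⊢
        · exact tendsto_nhds_unique h1 h2
        · exact tendsto_nhds_unique h1 tendsto_const_nhds
      rw [h3, ih]
      by_cases hkj : k = j <;> simp [hkj]

theorem orthonormal_lift (hD : IsToeplitzRoot D) (hu : residual D ≠ 0) :
    Orthonormal ℂ fun w => ((‖residual D‖⁻¹ : ℝ) : ℂ) • hD.lift w (residual D) := by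
  classical
  rw [orthonormal_iff_ite]
  intro w v
  rw [inner_smul_left, inner_smul_right, hD.inner_lift_lift, Complex.conj_ofReal]
  have h0 : ‖residual D‖ ≠ 0 := norm_ne_zero_iff.2 hu
  split_ifs
  · norm_cast
    field_simp
  · simp

/-- The isometry `z^ω ↦ W^ω u / ‖u‖` onto the pure part of the Toeplitz operator `D²`. -/
theorem exists_isometry (hD : IsToeplitzRoot D) (hu : residual D ≠ 0) : ∃ J : Fock ι →ₗᵢ[ℂ] Fock ι, ∀ w,
    J (monomial w) = ((‖residual D‖⁻¹ : ℝ) : ℂ) • hD.lift w (residual D) := by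
  classical
  refine ⟨(hD.orthonormal_lift hu).orthogonalFamily.linearIsometry, fun w => ?_⟩
  rw [monomial, OrthogonalFamily.linearIsometry_apply_single]
  simp

/-- The vectors `z_k` with `D z_k = - L_k* D² 1`. -/
def shiftDefect (hD : IsToeplitzRoot D) (k : ι) : Fock ι := -((hD.lift [k])†) (D (vacuum ι))

theorem apply_shiftDefect (hD : IsToeplitzRoot D) (k : ι) :
    D (hD.shiftDefect k) = -((leftShift k)†) (D (D (vacuum ι))) := by
  rw [shiftDefect, map_neg, hD.apply_adjoint_lift]
  have : wordShift [k] = leftShift k := by ext1 x; rw [wordShift_cons, wordShift_nil]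
  rw [this]

theorem inner_shiftDefect (hD : IsToeplitzRoot D) {v : Fock ι} (hv : D v = 0) (k : ι) :
    inner ℂ v (hD.shiftDefect k) = 0 := by
  rw [shiftDefect, inner_neg_right, hD.inner_adjoint_lift _ _ hv, neg_zero]

theorem mem_closure_range (hD : IsToeplitzRoot D) {z : Fock ι} (hz : ∀ v, D v = 0 → inner ℂ v z = 0) :
    z ∈ closure (Set.range D) := by
  have h1 : z ∈ (LinearMap.range (D : Fock ι →ₗ[ℂ] Fock ι))ᗮᗮ := by
    rw [Submodule.mem_orthogonal]
    intro v hv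
    apply hz
    rw [Submodule.mem_orthogonal] at hv
    refine ext_inner_left ℂ fun x => ?_
    rw [← hD.inner_left, inner_zero_right]
    exact hv _ ⟨x, rfl⟩
  rw [Submodule.orthogonal_orthogonal_eq_closure] at h1
  have h2 : z ∈ ((LinearMap.range (D : Fock ι →ₗ[ℂ] Fock ι)).topologicalClosure : Set _) := h1
  rwa [Submodule.topologicalClosure_coe] at h2

/-- Completing the square: by the Toeplitz identity the vectors `D L_k (q k)` are mutually
orthogonal, and the defining equation of `shiftDefect` rewrites the cross terms. -/
theorem norm_sq_apply_sub_sum (hD : IsToeplitzRoot D) (s : Finset ι) (q : ι → Fock ι) :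
    ‖D (vacuum ι - ∑ k ∈ s, leftShift k (q k))‖ ^ 2 =
      ‖D (vacuum ι)‖ ^ 2 - ∑ k ∈ s, ‖hD.shiftDefect k‖ ^ 2 +
        ∑ k ∈ s, ‖D (q k) + hD.shiftDefect k‖ ^ 2 := by
  classical
  have h1 : ‖D (∑ k ∈ s, leftShift k (q k))‖ ^ 2 = ∑ k ∈ s, ‖D (q k)‖ ^ 2 := by
    have : ((‖D (∑ k ∈ s, leftShift k (q k))‖ ^ 2 : ℝ) : ℂ) =
        ((∑ k ∈ s, ‖D (q k)‖ ^ 2 : ℝ) : ℂ) := by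
      have e := inner_self_eq_norm_sq_to_K (𝕜 := ℂ) (D (∑ k ∈ s, leftShift k (q k)))
      push_cast
      refine Eq.trans e.symm ?_
      rw [map_sum, sum_inner]
      refine Finset.sum_congr rfl fun k hk => ?_
      rw [inner_sum]
      simp only [hD.inner_shift]
      rw [Finset.sum_ite_eq, if_pos hk, inner_self_eq_norm_sq_to_K]
      rfl
    exact_mod_cast this
  have h2 : inner ℂ (D (vacuum ι)) (D (∑ k ∈ s, leftShift k (q k))) =
      -∑ k ∈ s, inner ℂ (hD.shiftDefect k) (D (q k)) := by
    rw [map_sum, inner_sum, ← Finset.sum_neg_distrib]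
    refine Finset.sum_congr rfl fun k _ => ?_
    rw [← hD.inner_left (hD.shiftDefect k), hD.apply_shiftDefect, inner_neg_left, neg_neg,
      ContinuousLinearMap.adjoint_inner_left, hD.inner_left (D (vacuum ι))]
  rw [map_sub, norm_sub_sq (𝕜 := ℂ), h1, h2]
  have h3 : ∀ k, ‖D (q k) + hD.shiftDefect k‖ ^ 2 = ‖D (q k)‖ ^ 2 +
      2 * RCLike.re (inner ℂ (hD.shiftDefect k) (D (q k))) + ‖hD.shiftDefect k‖ ^ 2 := fun k => by
    rw [norm_add_sq (𝕜 := ℂ), inner_re_symm]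
  simp only [h3, Finset.sum_add_distrib, map_neg, map_sum, ← Finset.mul_sum]
  ring

/-- Each `-shiftDefect k` is orthogonal to `ker D`, hence a limit of vectors `D q`, so the last sum
in the completed square can be made arbitrarily small. Minimising over polynomials leaves `‖residual
D‖²`. -/
theorem hasSum_norm_sq_shiftDefect (hD : IsToeplitzRoot D) :
    HasSum (fun k => ‖hD.shiftDefect k‖ ^ 2) (‖D (vacuum ι)‖ ^ 2 - ‖residual D‖ ^ 2) := by
  refine hasSum_of_isLUB_of_nonneg _ (fun k => by positivity) ⟨?_, fun B hB => ?_⟩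
  · rintro _ ⟨s, rfl⟩
    have h1 : ∀ k, ∃ q : ℕ → Fock ι, Tendsto (fun n => D (q n)) atTop
        (𝓝 (-hD.shiftDefect k)) := fun k => by
      have : -hD.shiftDefect k ∈ closure (Set.range D) := hD.mem_closure_range fun v hv => by
        rw [inner_neg_right, hD.inner_shiftDefect hv, neg_zero]
      rw [mem_closure_iff_seq_limit] at this
      obtain ⟨y, hy, hlim⟩ := this
      choose q hq using hy
      exact ⟨q, by simpa only [hq] using hlim⟩
    choose q hq using h1
    have h2 : Tendsto (fun n => ‖D (vacuum ι)‖ ^ 2 - ∑ k ∈ s, ‖hD.shiftDefect k‖ ^ 2 +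
        ∑ k ∈ s, ‖D (q k n) + hD.shiftDefect k‖ ^ 2) atTop
        (𝓝 (‖D (vacuum ι)‖ ^ 2 - ∑ k ∈ s, ‖hD.shiftDefect k‖ ^ 2 +
          ∑ k ∈ s, ‖-hD.shiftDefect k + hD.shiftDefect k‖ ^ 2)) :=
      tendsto_const_nhds.add (tendsto_finsetSum s fun k _ =>
        (((hq k).add tendsto_const_nhds).norm.pow 2))
    have h3 : ∀ n, ‖residual D‖ ^ 2 ≤ ‖D (vacuum ι)‖ ^ 2 - ∑ k ∈ s, ‖hD.shiftDefect k‖ ^ 2 +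
        ∑ k ∈ s, ‖D (q k n) + hD.shiftDefect k‖ ^ 2 := fun n => by
      rw [← hD.norm_sq_apply_sub_sum s fun k => q k n]
      have : (vacuum ι - ∑ k ∈ s, leftShift k (q k n)) [] = 1 := by
        rw [lp.coeFn_sub, Pi.sub_apply, vacuum_apply_nil, lp.coeFn_sum, Finset.sum_apply,
          Finset.sum_eq_zero fun k _ => leftShift_nil _ _, sub_zero]
      have := norm_residual_le (D := D) this
      gcongr
    have h4 := ge_of_tendsto' h2 h3
    simp only [neg_add_cancel, norm_zero, ne_eq, OfNat.ofNat_ne_zero, not_false_eq_true, zero_pow,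
      Finset.sum_const_zero, add_zero] at h4
    change ∑ k ∈ s, ‖hD.shiftDefect k‖ ^ 2 ≤ _
    linarith
  -- Least upper bound: dropping the squares bounds `‖D (x n)‖²` below by `‖D 1‖² - B`, and these
  -- norms converge to that of the residual.
  · obtain ⟨x, hx, hlim⟩ := exists_tendsto_residual (D := D)
    have h1 : ∀ n, ‖D (vacuum ι)‖ ^ 2 - B ≤ ‖D (x n)‖ ^ 2 := fun n => by
      obtain ⟨s, hs⟩ := exists_sum_leftShift_eq (hx n)
      have e : x n = vacuum ι - (vacuum ι - x n) := by rw [sub_sub_cancel]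
      rw [e, hs, hD.norm_sq_apply_sub_sum]
      have h2 : ∑ k ∈ s, ‖hD.shiftDefect k‖ ^ 2 ≤ B := hB ⟨s, rfl⟩
      have h3 : 0 ≤ ∑ k ∈ s, ‖D (((leftShift k)†) (vacuum ι - x n)) + hD.shiftDefect k‖ ^ 2 :=
        Finset.sum_nonneg fun k _ => by positivity
      linarith
    have := ge_of_tendsto' (hlim.norm.pow 2) h1
    linarith

/-- `S` is the outer factor of the pure part of `D²`. -/
structure IsOuterFactor (hD : IsToeplitzRoot D) (S : Fock ι →L[ℂ] Fock ι) : Prop where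
  commutes : CommutesWithShifts S
  apply_eq : ∀ h w, S h w = ((‖residual D‖⁻¹ : ℝ) : ℂ) * inner ℂ (hD.lift w (residual D)) (D h)
  norm_le : ∀ h, ‖S h‖ ≤ ‖D h‖
  denseRange : DenseRange S
  maximal : ∀ G : Fock ι →L[ℂ] Fock ι, CommutesWithShifts G → (∀ h, ‖G h‖ ≤ ‖D h‖) →
    ∀ h, ‖G h‖ ≤ ‖S h‖

theorem apply_lift_residual (hD : IsToeplitzRoot D) {G N : Fock ι →L[ℂ] Fock ι}
    (hG : CommutesWithShifts G) (hN : ∀ x, N (D x) = G x) (w : List ι) :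
    N (hD.lift w (residual D)) = wordShift w (N (residual D)) := by
  obtain ⟨x, -, hlim⟩ := exists_tendsto_residual (D := D)
  have h1 := (N.continuous.tendsto _).comp (hD.tendsto_lift_residual hlim w)
  have h2 := ((wordShift w).continuous.tendsto _).comp ((N.continuous.tendsto _).comp hlim)
  simp only [Function.comp_def, hN, hG.apply_wordShift] at h1 h2
  exact tendsto_nhds_unique h1 h2

/-- The coefficients of `J* D h` are the inner products of `D h` with the normalized wandering
family, so the shift relations of that family make `J* D` commute with the left shifts. -/
theorem isOuterFactor_of_isometry (hD : IsToeplitzRoot D) (hu : residual D ≠ 0)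
    {J : Fock ι →ₗᵢ[ℂ] Fock ι}
    (hJ : ∀ w, J (monomial w) = ((‖residual D‖⁻¹ : ℝ) : ℂ) • hD.lift w (residual D)) :
    hD.IsOuterFactor ((J.toContinuousLinearMap)† ∘L D) := by
  classical
  set S := (J.toContinuousLinearMap)† ∘L D with hSdef
  have h0 : ‖residual D‖ ≠ 0 := norm_ne_zero_iff.2 hu
  have hJJ : ∀ x, ((J.toContinuousLinearMap)†) (J x) = x := fun x => by
    refine ext_inner_left ℂ fun y => ?_
    rw [ContinuousLinearMap.adjoint_inner_right]
    exact J.inner_map_map y x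
  have happ : ∀ h w, S h w =
      ((‖residual D‖⁻¹ : ℝ) : ℂ) * inner ℂ (hD.lift w (residual D)) (D h) := fun h w => by
    rw [← inner_monomial_left, hSdef, ContinuousLinearMap.comp_apply,
      ContinuousLinearMap.adjoint_inner_right]
    change inner ℂ (J (monomial w)) (D h) = _
    rw [hJ, inner_smul_left, Complex.conj_ofReal]
  have hcomm : CommutesWithShifts S := fun k x => by
    apply lp.ext; funext w
    rw [happ]
    cases w with
    | nil =>
      rw [leftShift_nil, hD.lift_nil_residual, inner_residual_eq_zero (leftShift_nil k x), mul_zero]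
    | cons j v =>
      rw [leftShift_cons, happ, ← inner_conj_symm, hD.inner_apply_leftShift_lift]
      by_cases h : j = k
      · rw [if_pos h.symm, if_pos h, inner_conj_symm]
      · rw [if_neg (Ne.symm h), if_neg h, map_zero, mul_zero]
  -- The residual lies in the range of `J`, hence is fixed by `J J*`; maximality rests on this.
  have hres : J (((‖residual D‖ : ℝ) : ℂ) • vacuum ι) = residual D := by
    rw [map_smul, vacuum_eq_monomial, hJ, hD.lift_nil_residual, smul_smul, ← Complex.ofReal_mul,
      mul_inv_cancel₀ h0, Complex.ofReal_one, one_smul]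
  have hJnorm : ∀ x, ‖((J.toContinuousLinearMap)†) x‖ ≤ ‖x‖ := fun x =>
    norm_apply_le_of_contraction (norm_adjoint_le_one J.norm_toContinuousLinearMap_le) x
  refine ⟨hcomm, happ, fun h => hJnorm _, ?_, fun G hG hle => ?_⟩
  -- The range of `J` is orthogonal to `ker D`. If `x` is orthogonal to the range of `J* D`, then `D
  -- J x = 0`, so `J x` is orthogonal to itself.
  · have hker : ∀ v, D v = 0 → ∀ x, inner ℂ v (J x) = 0 := fun v hv x => by
      have : (innerSL ℂ v) ∘L J.toContinuousLinearMap = 0 := by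
        apply eq_of_apply_monomial_eq
        intro w
        change inner ℂ v (J (monomial w)) = 0
        obtain ⟨x, -, hlim⟩ := exists_tendsto_residual (D := D)
        have h1 := (tendsto_const_nhds (x := v)).inner (𝕜 := ℂ) (hD.tendsto_lift_residual hlim w)
        simp only [← hD.inner_left, hv, inner_zero_left] at h1
        rw [hJ, inner_smul_right, ← tendsto_nhds_unique tendsto_const_nhds h1, mul_zero]
      exact DFunLike.congr_fun this x
    have hbot : (LinearMap.range (S : Fock ι →ₗ[ℂ] Fock ι))ᗮ = ⊥ := by
      rw [Submodule.eq_bot_iff]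
      intro x hx
      rw [Submodule.mem_orthogonal] at hx
      have h1 : D (J x) = 0 := by
        refine ext_inner_left ℂ fun y => ?_
        have := hx (S y) ⟨y, rfl⟩
        rw [hSdef, ContinuousLinearMap.comp_apply, ContinuousLinearMap.adjoint_inner_left] at this
        rw [← hD.inner_left, inner_zero_right]
        exact this
      have h2 := hker _ h1 x
      rw [inner_self_eq_zero] at h2
      exact (map_eq_zero_iff J J.injective).1 h2
    have hdense := (Submodule.topologicalClosure_eq_top_iff
      (K := LinearMap.range (S : Fock ι →ₗ[ℂ] Fock ι))).2 hbot
    exact Submodule.dense_iff_topologicalClosure_eq_top.2 hdense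
  · obtain ⟨N, hNle, hN, -⟩ := exists_contraction_comp_eq G D hle
    have hNJ : CommutesWithShifts (N ∘L J.toContinuousLinearMap) := by
      intro k x
      have hw : ∀ w, N (J (monomial w)) =
          wordShift w (((‖residual D‖⁻¹ : ℝ) : ℂ) • N (residual D)) := fun w => by
        rw [hJ, map_smul, hD.apply_lift_residual hG hN, map_smul]
      have : (N ∘L J.toContinuousLinearMap) ∘L leftShift k =
          leftShift k ∘L (N ∘L J.toContinuousLinearMap) := by
        apply eq_of_apply_monomial_eq
        intro w
        change N (J (leftShift k (monomial w))) = leftShift k (N (J (monomial w)))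
        rw [leftShift_monomial, hw, hw, wordShift_cons]
      exact DFunLike.congr_fun this x
    -- With `G = N D`, the operator `G - N J S` commutes with the shifts. Along `x n` with `D (x n)`
    -- tending to the residual `u`, its values tend to `N u - N J J* u = 0`, although `x n` has
    -- constant term `1`; the lower bound for non-zero multipliers forces it to vanish.
    have hzero : G - (N ∘L J.toContinuousLinearMap) ∘L S = 0 := by
      by_contra hne
      obtain ⟨ε, hε, hbd⟩ := (hG.sub (hNJ.comp hcomm)).exists_le_norm hne
      obtain ⟨x, hx, hlim⟩ := exists_tendsto_residual (D := D)
      have h1 : Tendsto (fun n => N (D (x n)) - N (J (((J.toContinuousLinearMap)†) (D (x n)))))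
          atTop (𝓝 (N (residual D) - N (J (((J.toContinuousLinearMap)†) (residual D))))) :=
        ((N.continuous.tendsto _).comp hlim).sub (((N.continuous.comp (J.continuous.comp
          (ContinuousLinearMap.continuous _))).tendsto _).comp hlim)
      rw [← hres, hJJ, sub_self] at h1
      have h2 := ge_of_tendsto' h1.norm fun n => by
        have := hbd (x n) (apply_nil_eq_one (hx n))
        rw [sub_apply, ← hN] at this
        exact this
      rw [norm_zero] at h2
      exact absurd h2 (not_le.2 hε)
    intro h
    rw [sub_eq_zero.1 hzero]
    exact (hNle _).trans (J.norm_map _).le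

theorem exists_isOuterFactor (hD : IsToeplitzRoot D) (hu : residual D ≠ 0) :
    ∃ S, hD.IsOuterFactor S := by
  obtain ⟨J, hJ⟩ := hD.exists_isometry hu
  exact ⟨_, hD.isOuterFactor_of_isometry hu hJ⟩

namespace IsOuterFactor

variable {hD : IsToeplitzRoot D} {S : Fock ι →L[ℂ] Fock ι}

theorem apply_nil (hS : hD.IsOuterFactor S) (x : Fock ι) :
    S x [] = ((‖residual D‖ : ℝ) : ℂ) * x [] := by
  rw [hS.apply_eq, hD.lift_nil_residual, inner_residual_apply]
  by_cases h0 : ‖residual D‖ = 0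
  · simp [h0]
  · push_cast
    have : (‖residual D‖ : ℂ) ≠ 0 := by exact_mod_cast h0
    field_simp

/-- The Szegő infimum of `D² - S* S` is not positive: the constant coefficient of `S x` already has
modulus `‖residual D‖` when `x(0) = 1`, while `‖D x‖` can approach that value. -/
theorem exists_norm_sq_sub_lt (hS : hD.IsOuterFactor S) {ε : ℝ} (hε : 0 < ε) :
    ∃ x : Fock ι, x [] = 1 ∧ ‖D x‖ ^ 2 - ‖S x‖ ^ 2 < ε := by
  obtain ⟨x, hx, hlim⟩ := exists_tendsto_residual (D := D)
  obtain ⟨n, hn⟩ := ((hlim.norm.pow 2).eventually_lt_const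
    (lt_add_of_pos_right (‖residual D‖ ^ 2) hε)).exists
  refine ⟨x n, apply_nil_eq_one (hx n), ?_⟩
  have h1 := norm_coeff_le (S (x n)) []
  rw [hS.apply_nil, apply_nil_eq_one (hx n), mul_one, Complex.norm_real, norm_norm] at h1
  have h2 : ‖residual D‖ ^ 2 ≤ ‖S (x n)‖ ^ 2 := by gcongr
  linarith

theorem eq_zero_of_norm_sq_add_le (hS : hD.IsOuterFactor S) {G : Fock ι →L[ℂ] Fock ι}
    (hG : CommutesWithShifts G) (h : ∀ x, ‖S x‖ ^ 2 + ‖G x‖ ^ 2 ≤ ‖D x‖ ^ 2) : G = 0 := by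
  by_contra hne
  obtain ⟨ε, hε, hbd⟩ := hG.exists_le_norm hne
  obtain ⟨x, hx, hlt⟩ := hS.exists_norm_sq_sub_lt (ε := ε ^ 2) (by positivity)
  have h1 : ε ^ 2 ≤ ‖G x‖ ^ 2 := by
    have := hbd x hx
    gcongr
  linarith [h x]

theorem residual_eq_zero_of_norm_sq_add_le (hS : hD.IsOuterFactor S) {D' : Fock ι →L[ℂ] Fock ι}
    (h : ∀ x, ‖S x‖ ^ 2 + ‖D' x‖ ^ 2 ≤ ‖D x‖ ^ 2) : residual D' = 0 := by
  by_contra hne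
  have hpos := norm_pos_iff.2 hne
  obtain ⟨x, hx, hlt⟩ := hS.exists_norm_sq_sub_lt (ε := ‖residual D'‖ ^ 2) (by positivity)
  have h1 : ‖residual D'‖ ^ 2 ≤ ‖D' x‖ ^ 2 := by
    have := norm_residual_le (D := D') hx
    gcongr
  linarith [h x]

end IsOuterFactor

end IsToeplitzRoot

open IsToeplitzRoot

theorem norm_vacuum : ‖vacuum ι‖ = 1 := by
  have h' := norm_sq_eq_re_inner (𝕜 := ℂ) (vacuum ι)
  nth_rewrite 2 [vacuum_eq_monomial] at h'
  rw [inner_monomial_left, vacuum_apply_nil, RCLike.one_re] at h'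
  exact (pow_eq_one_iff_of_nonneg (norm_nonneg _) two_ne_zero).1 h'

theorem adjoint_wordShift_vacuum {w : List ι} (hw : w ≠ []) :
    ((wordShift w)†) (vacuum ι) = 0 := by
  refine ext_inner_right ℂ fun x => ?_
  rw [ContinuousLinearMap.adjoint_inner_left, vacuum_eq_monomial, inner_monomial_left,
    wordShift_apply_nil hw, inner_zero_left]

theorem adjoint_leftShift_vacuum (k : ι) : ((leftShift k)†) (vacuum ι) = 0 := by
  refine ext_inner_right ℂ fun x => ?_
  rw [ContinuousLinearMap.adjoint_inner_left, vacuum_eq_monomial, inner_monomial_left,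
    leftShift_nil, inner_zero_left]

/-! ### The backward shift in a complementary space -/

section Complementary

variable {H : Type*} [NormedAddCommGroup H] [InnerProductSpace ℂ H] [CompleteSpace H]
  {T : Fock ι →L[ℂ] H}

open Classical in
theorem isToeplitzRoot_defect (hT : ‖T‖ ≤ 1)
    (h : ∀ k j x y, inner ℂ (T (leftShift k x)) (T (leftShift j y)) =
      if k = j then inner ℂ (T x) (T y) else 0) : IsToeplitzRoot (defect T) where
  inner_left := inner_defect_left T
  inner_shift k j x y := by
    rw [inner_defect_defect hT, inner_defect_defect hT, inner_leftShift, h]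
    split_ifs <;> simp

/-- The norm of the backward shift `L* T 1` in the complementary space of `T`. -/
theorem exists_lp_incl_eq (hT : ‖T‖ ≤ 1) (hD : IsToeplitzRoot (defect T)) {f : ι → H} {β : ℝ}
    (hf : ∀ k, (T†) (f k) = ((leftShift k)†) ((T†) (T (vacuum ι))))
    (hsum : HasSum (fun k => ‖f k‖ ^ 2) (‖T (vacuum ι)‖ ^ 2 - β)) :
    ∃ F : lp (fun _ : ι => ComplementarySpace T) 2, (∀ k, OperatorRange.incl _ (F k) = f k) ∧
      ‖F‖ ^ 2 = 1 - β - ‖residual (defect T)‖ ^ 2 := by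
  -- Since `L_k* 1 = 0`, one has `L_k* T* T 1 = -L_k* D² 1`, which is the equation solved by
  -- `shiftDefect`.
  have h1 : ∀ k, (T†) (f k) = defect T (hD.shiftDefect k) := fun k => by
    rw [hf, hD.apply_shiftDefect, defect_defect hT, map_sub, adjoint_leftShift_vacuum]
    simp
  choose F hF using fun k => exists_incl_eq_of_adjoint_eq hT (h1 k)
  have h2 : ∀ k, ‖F k‖ ^ 2 = ‖f k‖ ^ 2 + ‖hD.shiftDefect k‖ ^ 2 := fun k => by
    have h3 := h1 k
    rw [← hF k] at h3
    have h4 := inner_complementarySpace hT h3 h3 (fun v hv => hD.inner_shiftDefect hv k)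
      (fun v hv => hD.inner_shiftDefect hv k)
    rw [hF, inner_self_eq_norm_sq_to_K, inner_self_eq_norm_sq_to_K,
      inner_self_eq_norm_sq_to_K] at h4
    exact_mod_cast h4
  have h5 : HasSum (fun k => ‖F k‖ ^ 2) (1 - β - ‖residual (defect T)‖ ^ 2) := by
    have h6 := hsum.add hD.hasSum_norm_sq_shiftDefect
    rw [norm_sq_defect hT, norm_vacuum] at h6
    simp only [h2]
    convert h6 using 1
    ring
  have hmem : Memℓp F 2 := memℓp_gen (by simpa using h5.summable)
  refine ⟨⟨F, hmem⟩, hF, ?_⟩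
  have h7 := lp.hasSum_norm (p := 2) (by norm_num)
    (⟨F, hmem⟩ : lp (fun _ : ι => ComplementarySpace T) 2)
  simp only [ENNReal.toReal_ofNat, Real.rpow_ofNat] at h7
  exact h7.unique h5

end Complementary

/-! ### Norms of `𝐛` and `𝐜` -/

section Columns

variable {κ : Type*} [Fintype κ]

theorem inner_colR (c : κ → Hinf ι) (x y : Fock ι) :
    inner ℂ (colR c x) (colR c y) = ∑ j, inner ℂ ((c j).opR x) ((c j).opR y) := by
  rw [PiLp.inner_apply]; rfl

theorem adjoint_colR (c : κ → Hinf ι) (f : PiLp 2 fun _ : κ => Fock ι) :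
    ((colR c)†) f = ∑ j, ((c j).opR†) (f j) := by
  refine ext_inner_right ℂ fun x => ?_
  rw [ContinuousLinearMap.adjoint_inner_left, PiLp.inner_apply, sum_inner]
  refine Finset.sum_congr rfl fun j _ => ?_
  rw [ContinuousLinearMap.adjoint_inner_left]; rfl

theorem isToeplitzRoot_defect_colR {c : κ → Hinf ι} (hc : ‖colR c‖ ≤ 1) :
    IsToeplitzRoot (defect (colR c)) := by
  classical
  refine isToeplitzRoot_defect hc fun k j x y => ?_
  simp only [inner_colR, (Hinf.commutes_opR _).inner_leftShift]
  split_ifs <;> simp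

theorem isToeplitzRoot_defect_opR {b : Hinf ι} (hb : ‖b.opR‖ ≤ 1) :
    IsToeplitzRoot (defect b.opR) := by
  classical
  exact isToeplitzRoot_defect hb fun k j x y => b.commutes_opR.inner_leftShift k j x y

theorem hasSum_norm_sq_backwardShift (b : Hinf ι) :
    HasSum (fun k => ‖((leftShift k)†) b.transpose‖ ^ 2)
      (‖b.opR (vacuum ι)‖ ^ 2 - ‖b.coeff []‖ ^ 2) := by
  have := hasSum_norm_sq_adjoint_leftShift b.transpose
  rwa [Hinf.transpose_apply] at this

theorem exists_isBackwardShift {b : Hinf ι} (hb : ‖b.opR‖ ≤ 1) :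
    ∃ bb : lp (fun _ : ι => Ht b) 2, IsBackwardShift b bb ∧
      ‖bb‖ ^ 2 = 1 - ‖b.coeff []‖ ^ 2 - ‖residual (defect b.opR)‖ ^ 2 :=
  exists_lp_incl_eq hb (isToeplitzRoot_defect_opR hb)
    (fun k => b.commutes_opR.adjoint_apply k _) (hasSum_norm_sq_backwardShift b)

theorem exists_isBackwardShiftCol {c : κ → Hinf ι} (hc : ‖colR c‖ ≤ 1) :
    ∃ cc : lp (fun _ : ι => HtCol c) 2, IsBackwardShiftCol c cc ∧
      ‖cc‖ ^ 2 = 1 - ∑ j, ‖(c j).coeff []‖ ^ 2 - ‖residual (defect (colR c))‖ ^ 2 := by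
  -- The ambient candidate for `𝐜`; in `exists_lp_incl_eq` the parameter `β` is then the squared
  -- norm of the constant coefficients.
  let f : ι → PiLp 2 fun _ : κ => Fock ι :=
    fun k => WithLp.toLp 2 fun j => ((leftShift k)†) (c j).transpose
  have hf : ∀ k, ((colR c)†) (f k) = ((leftShift k)†) (((colR c)†) (colR c (vacuum ι))) :=
    fun k => by
      rw [adjoint_colR, adjoint_colR, map_sum]
      exact Finset.sum_congr rfl fun j _ => (c j).commutes_opR.adjoint_apply k _
  have hsum : HasSum (fun k => ‖f k‖ ^ 2)
      (‖colR c (vacuum ι)‖ ^ 2 - ∑ j, ‖(c j).coeff []‖ ^ 2) := by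
    simp only [PiLp.norm_sq_eq_of_L2, ← Finset.sum_sub_distrib]
    exact hasSum_sum fun j _ => hasSum_norm_sq_backwardShift (c j)
  obtain ⟨cc, h1, h2⟩ := exists_lp_incl_eq hc (isToeplitzRoot_defect_colR hc) hf hsum
  exact ⟨cc, fun k j => by rw [HtCol.incl, h1], h2⟩

end Columns

/-! ### Identification of the Sarason function -/

section Sarason

variable {b : Hinf ι}

theorem norm_opR_le_one (hb : ‖b.opL‖ ≤ 1) : ‖b.opR‖ ≤ 1 :=
  ContinuousLinearMap.opNorm_le_bound _ zero_le_one fun h => by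
    rw [one_mul]; exact (norm_opL_le_one_iff b).1 hb h

/-- The backward shifts `L_k*` restrict to bounded operators on `𝓗^t(b)`. -/
theorem exists_restrict_adjoint_leftShift (hb : ‖b.opR‖ ≤ 1) (k : ι) :
    ∃ X : Ht b →L[ℂ] Ht b, ∀ f, Ht.incl b (X f) = ((leftShift k)†) (Ht.incl b f) := by
  have hD := isToeplitzRoot_defect_opR hb
  refine OperatorRange.exists_restrict (codefect b.opR) ((leftShift k)†)
    -- With `f = L_k* √(I - b(R) b(R)*) g`, the solution of `b(R)* f = D z` is `z = (W^k)* b(R)* g`;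
    -- the preimage is the one of `codefect_of_adjoint_eq`.
    (codefect b.opR ∘L ((leftShift k)†) ∘L codefect b.opR +
      b.opR ∘L ((hD.lift [k])†) ∘L (b.opR†)) fun g => ?_
  refine (codefect_of_adjoint_eq hb ?_).symm
  have : wordShift [k] = leftShift k := by ext1 x; rw [wordShift_cons, wordShift_nil]
  rw [b.commutes_opR.adjoint_apply, adjoint_apply_codefect hb, ← this, ← hD.apply_adjoint_lift]
  rfl

/-- Taking adjoints reverses the order of the letters; this matches the reversal in `F(R) 1 = F^t`.
-/
theorem incl_prod_map {X : ι → Ht b →L[ℂ] Ht b}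
    (hX : ∀ k f, Ht.incl b (X k f) = ((leftShift k)†) (Ht.incl b f)) (w : List ι) (f : Ht b) :
    Ht.incl b ((w.map X).prod f) = ((wordShift w.reverse)†) (Ht.incl b f) := by
  induction w with
  | nil =>
    have : (wordShift ([] : List ι)) = ContinuousLinearMap.id ℂ (Fock ι) := rfl
    rw [List.reverse_nil, this, ContinuousLinearMap.adjoint_id]
    rfl
  | cons k w ih =>
    rw [List.map_cons, List.prod_cons, mul_apply_eq_comp, hX, ih, List.reverse_cons]
    have : wordShift (w.reverse ++ [k]) = wordShift w.reverse ∘L leftShift k := by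
      ext1 x; rw [wordShift_append, wordShift_cons, wordShift_nil]; rfl
    rw [this, ContinuousLinearMap.adjoint_comp]; rfl

/-- The Sarason coefficients reduce to `⟨W^{ω^t} u, D 1⟩ / ‖u‖`, with `u` the residual: these are
the coefficients of the outer factor. -/
theorem isSarasonFunction_of_isOuterFactor (hb : ‖b.opR‖ ≤ 1)
    (hu : residual (defect b.opR) ≠ 0) {a : Hinf ι}
    (ha : (isToeplitzRoot_defect_opR hb).IsOuterFactor a.opR) : IsSarasonFunction b a := by
  have hD := isToeplitzRoot_defect_opR hb
  have hα : 0 < ‖residual (defect b.opR)‖ := norm_pos_iff.2 hu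
  have hαc : (‖residual (defect b.opR)‖ : ℂ) ≠ 0 := by exact_mod_cast hα.ne'
  choose X hX using exists_restrict_adjoint_leftShift hb
  obtain ⟨bb, hbb, hnorm⟩ := exists_isBackwardShift hb
  -- `b(R)* b(R) 1 = 1 - D² 1`, and `1 = ‖u‖⁻² D u` by `apply_residual`.
  have hbt : (b.opR†) (b.opR (vacuum ι)) =
      (defect b.opR) ((((‖residual (defect b.opR)‖ ^ 2)⁻¹ : ℝ) : ℂ) • residual (defect b.opR) - (defect b.opR) (vacuum ι)) := by
    rw [map_sub, map_smul, hD.apply_residual, defect_defect hb, smul_smul, ← Complex.ofReal_mul,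
      inv_mul_cancel₀ (by positivity), Complex.ofReal_one, one_smul, sub_sub_cancel]
  obtain ⟨bt, hbt'⟩ := exists_incl_eq_of_adjoint_eq hb hbt
  have ha0 : a.coeff [] = ((‖residual (defect b.opR)‖ : ℝ) : ℂ) := by
    rw [Hinf.coeff_eq, List.reverse_nil, ha.apply_nil, vacuum_apply_nil, mul_one]
  have hval : 1 - ‖b.coeff []‖ ^ 2 - ‖bb‖ ^ 2 = ‖residual (defect b.opR)‖ ^ 2 := by rw [hnorm]; ring
  refine ⟨X, bt, bb, hX, hbt', hbb, ?_, ?_, fun w hw => ?_⟩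
  · rw [hval]; positivity
  · rw [hval, Real.sqrt_sq hα.le, ha0]
  · have hw' : w.reverse ≠ [] := by simpa using hw
    have hf := incl_prod_map hX w bt
    have hz : (b.opR†) (Ht.incl b ((w.map X).prod bt)) =
        (defect b.opR) (-((hD.lift w.reverse)†) ((defect b.opR) (vacuum ι))) := by
      rw [hf, b.commutes_opR.adjoint_apply_wordShift, map_neg, hD.apply_adjoint_lift,
        defect_defect hb, map_sub, adjoint_wordShift_vacuum hw', zero_sub, neg_neg]
      exact congrArg (fun x => ((wordShift w.reverse)†) ((b.opR†) x)) hbt'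
    have hin := inner_complementarySpace hb (F₁ := bt) (F₂ := (w.map X).prod bt)
      ((congrArg _ hbt').trans hbt) hz
      (fun v hv => by
        rw [inner_sub_right, inner_smul_right, hD.inner_residual_of_apply_eq_zero hv,
          ← hD.inner_left, hv, inner_zero_left, mul_zero, sub_zero])
      (fun v hv => by rw [inner_neg_right, hD.inner_adjoint_lift _ _ hv, neg_zero])
    -- The `D 1` part of the vector attached to `b^t` cancels the ambient inner product exactly, so
    -- only the multiple of the residual contributes.
    have hcancel : inner ℂ ((defect b.opR) (vacuum ι)) (-((hD.lift w.reverse)†) ((defect b.opR) (vacuum ι))) =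
        inner ℂ (OperatorRange.incl _ bt) (OperatorRange.incl _ ((w.map X).prod bt)) := by
      rw [hD.inner_left, ← hz, ContinuousLinearMap.adjoint_inner_right]
      exact congrArg (fun x => inner ℂ x (Ht.incl b ((w.map X).prod bt))) hbt'.symm
    rw [hin, inner_sub_left, hcancel, add_sub_cancel, inner_smul_left, inner_neg_right,
      ContinuousLinearMap.adjoint_inner_right, Hinf.coeff_eq, ha.apply_eq, ha0,
      Complex.conj_ofReal]
    push_cast
    field_simp

theorem IsSarasonFunction.unique {a a' : Hinf ι} (h : IsSarasonFunction b a)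
    (h' : IsSarasonFunction b a') : a = a' := by
  obtain ⟨X, bt, bb, hX, hbt, hbb, -, h0, hw⟩ := h
  obtain ⟨X', bt', bb', hX', hbt', hbb', -, h0', hw'⟩ := h'
  have hi : Function.Injective (Ht.incl b) := OperatorRange.incl_injective _
  obtain rfl : X = X' := by
    funext k; ext1 f
    exact hi ((hX k f).trans (hX' k f).symm)
  obtain rfl : bt = bt' := hi (hbt.trans hbt'.symm)
  obtain rfl : bb = bb' := by
    apply lp.ext; funext k
    exact hi ((hbb k).trans (hbb' k).symm)
  have hc : a.coeff [] = a'.coeff [] := h0.trans h0'.symm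
  apply Hinf.ext_coeff
  funext w
  by_cases hwn : w = []
  · rw [hwn, hc]
  · rw [hw w hwn, hw' w hwn, hc]

theorem re_inner_one_sub_right (T : Fock ι →L[ℂ] Fock ι) (x : Fock ι) :
    (inner ℂ x ((1 - T† ∘L T) x)).re = ‖x‖ ^ 2 - ‖T x‖ ^ 2 := by
  rw [← re_inner_one_sub]
  exact inner_re_symm (𝕜 := ℂ) _ _

theorem re_inner_adjoint_comp (T : Fock ι →L[ℂ] Fock ι) (x : Fock ι) :
    RCLike.re (inner ℂ ((T† ∘L T) x) x) = ‖T x‖ ^ 2 := by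
  rw [ContinuousLinearMap.comp_apply, ContinuousLinearMap.adjoint_inner_left,
    inner_self_eq_norm_sq_to_K]
  norm_cast

theorem adjoint_comp_le_iff (S : Fock ι →L[ℂ] Fock ι) {Q : Fock ι →L[ℂ] Fock ι}
    (hQ : IsSelfAdjoint Q) :
    S† ∘L S ≤ Q ↔ ∀ x, ‖S x‖ ^ 2 ≤ RCLike.re (inner ℂ (Q x) x) := by
  have hS : IsSelfAdjoint (S† ∘L S) := (ContinuousLinearMap.isPositive_adjoint_comp_self S).1 |>
    ContinuousLinearMap.isSelfAdjoint_iff_isSymmetric.2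
  rw [ContinuousLinearMap.le_def, ContinuousLinearMap.isPositive_def']
  simp only [hQ.sub hS, true_and, ContinuousLinearMap.reApplyInnerSelf_apply, sub_apply,
    inner_sub_left, map_sub, re_inner_adjoint_comp, sub_nonneg]

/-- A non-zero `f` with `(b; f)` contractive gives `‖D x‖ ≥ ‖f(R) x‖ ≥ ε` on all `x` with `x(0) =
1`, so the Szegő infimum is positive. -/
theorem residual_ne_zero_of_not_isColumnExtreme (hb : ‖b.opL‖ ≤ 1) (hCE : ¬ IsColumnExtreme b) :
    residual (defect b.opR) ≠ 0 := by
  have hbR := norm_opR_le_one hb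
  rw [IsColumnExtreme, not_and] at hCE
  have := hCE hb
  push Not at this
  obtain ⟨f, hf, w, hw⟩ := this
  rw [norm_colL_le_one_iff] at hf
  simp only [Fin.sum_univ_two, Matrix.cons_val_zero, Matrix.cons_val_one] at hf
  have hne : f.opR ≠ 0 := fun h => hw (Hinf.coeff_eq_zero_of_opR_eq_zero h w)
  obtain ⟨ε, hε, hbd⟩ := f.commutes_opR.exists_le_norm hne
  intro h0
  have hglb := (isGLB_norm_residual_sq (D := defect b.opR)).2
  have : ε ^ 2 ≤ ‖residual (defect b.opR)‖ ^ 2 := by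
    refine hglb ?_
    rintro r ⟨p, -, hp0, rfl⟩
    have h1 : ε ≤ ‖f.opR (vacuum ι - p)‖ := hbd _ (by
      rw [lp.coeFn_sub, Pi.sub_apply, vacuum_apply_nil, hp0, sub_zero])
    have h2 : ε ^ 2 ≤ ‖f.opR (vacuum ι - p)‖ ^ 2 := by gcongr
    rw [norm_sq_defect hbR]
    linarith [hf (vacuum ι - p)]
  rw [h0, norm_zero] at this
  nlinarith

end Sarason

end FreeSarason

end

/-! ### The main theorem -/

open FreeSarason in
theorem mainTheorem3 {ι : Type*} [Countable ι] (b : Hinf ι) (hb : ‖b.opL‖ ≤ 1)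
    (hCE : ¬ IsColumnExtreme b) :
    (∃! a : Hinf ι, IsSarasonFunction b a) ∧
    ∀ a : Hinf ι, IsSarasonFunction b a →
      ‖a.opL‖ ≤ 1 ∧
      a.IsOuter ∧
      IsMaximalFactorizableMinorant (1 - b.opR† ∘L b.opR) (a.opR† ∘L a.opR) ∧
      IsGLB {r : ℝ | ∃ p : Fock ι, IsFreePolynomial p ∧ p [] = 0 ∧
          r = (inner ℂ (vacuum ι - p) ((1 - b.opR† ∘L b.opR) (vacuum ι - p))).re}
        (‖a.coeff []‖ ^ 2) ∧
      IsColumnExtremeCol ![b, a] ∧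
      ∃ (bb : lp (fun _ : ι => Ht b) 2) (cc : lp (fun _ : ι => HtCol ![b, a]) 2),
        IsBackwardShift b bb ∧ IsBackwardShiftCol ![b, a] cc ∧ ‖cc‖ = ‖bb‖ := by
  have hbR := norm_opR_le_one hb
  have hu := residual_ne_zero_of_not_isColumnExtreme hb hCE
  have hD := isToeplitzRoot_defect_opR hbR
  obtain ⟨S, hS⟩ := hD.exists_isOuterFactor hu
  obtain ⟨a₀, rfl⟩ := Hinf.exists_opR_eq hS.commutes
  have ha₀ := isSarasonFunction_of_isOuterFactor hbR hu hS
  refine ⟨⟨a₀, ha₀, fun a ha => ha.unique ha₀⟩, fun a ha => ?_⟩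
  -- Uniqueness replaces an arbitrary Sarason function by the outer factor, so all properties are
  -- read off from `hS`.
  obtain rfl : a = a₀ := ha.unique ha₀
  have ha0 : a.coeff [] = ((‖IsToeplitzRoot.residual (defect b.opR)‖ : ℝ) : ℂ) := by
    rw [Hinf.coeff_eq, List.reverse_nil, hS.apply_nil, vacuum_apply_nil, mul_one]
  have hsa : IsSelfAdjoint (1 - b.opR† ∘L b.opR) := IsSelfAdjoint.of_nonneg (one_sub_nonneg hbR)
  have hsum : ∀ h, ‖a.opR h‖ ^ 2 + ‖b.opR h‖ ^ 2 ≤ ‖h‖ ^ 2 := fun h => by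
    have h1 := hS.norm_le h
    have h2 : ‖a.opR h‖ ^ 2 ≤ ‖defect b.opR h‖ ^ 2 := by gcongr
    rw [norm_sq_defect hbR] at h2
    linarith
  have hcol : ∀ h, ∑ j, ‖((![b, a] : Fin 2 → Hinf ι) j).opR h‖ ^ 2 ≤ ‖h‖ ^ 2 := fun h => by
    simp only [Fin.sum_univ_two, Matrix.cons_val_zero, Matrix.cons_val_one]
    linarith [hsum h]
  have hcR : ‖colR ![b, a]‖ ≤ 1 := (norm_colR_le_one_iff _).2 hcol
  refine ⟨?_, hS.denseRange, ⟨⟨⟨a, rfl⟩, ?_⟩, ?_⟩, ?_, ⟨(norm_colL_le_one_iff _).2 hcol, ?_⟩, ?_⟩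
  · rw [norm_opL_le_one_iff]
    intro h
    refine (sq_le_sq₀ (norm_nonneg _) (norm_nonneg _)).1 ?_
    linarith [hsum h, sq_nonneg ‖b.opR h‖]
  · rw [adjoint_comp_le_iff _ hsa]
    intro x
    rw [re_inner_one_sub]
    linarith [hsum x]
  · rintro _ ⟨⟨g, rfl⟩, hg⟩
    rw [adjoint_comp_le_iff _ hsa] at hg
    rw [adjoint_comp_le_iff _ (ContinuousLinearMap.isSelfAdjoint_iff_isSymmetric.2
      (ContinuousLinearMap.isPositive_adjoint_comp_self a.opR).1)]
    intro x
    rw [re_inner_adjoint_comp]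
    have := hS.maximal g.opR g.commutes_opR (fun h => by
      refine (sq_le_sq₀ (norm_nonneg _) (norm_nonneg _)).1 ?_
      rw [norm_sq_defect hbR, ← re_inner_one_sub]
      exact hg h) x
    gcongr
  · have := IsToeplitzRoot.isGLB_norm_residual_sq (D := defect b.opR)
    simpa only [norm_sq_defect hbR, re_inner_one_sub_right, ha0, Complex.norm_real,
      norm_norm] using this
  · intro f hf j w
    rw [norm_colL_le_one_iff] at hf
    apply Hinf.coeff_eq_zero_of_opR_eq_zero
    refine hS.eq_zero_of_norm_sq_add_le (f j).commutes_opR fun x => ?_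
    have h1 := hf x
    rw [Fintype.sum_sum_type] at h1
    simp only [Sum.elim_inl, Sum.elim_inr] at h1
    rw [Fin.sum_univ_two (fun i => ‖((![b, a] : Fin 2 → Hinf ι) i).opR x‖ ^ 2)] at h1
    have h2 := Finset.single_le_sum (f := fun i => ‖(f i).opR x‖ ^ 2)
      (fun i _ => sq_nonneg _) (Finset.mem_univ j)
    simp only [Matrix.cons_val_zero, Matrix.cons_val_one] at h1 h2
    rw [norm_sq_defect hbR]
    linarith
  · obtain ⟨bb, hbb, hbn⟩ := exists_isBackwardShift hbR
    obtain ⟨cc, hcc, hcn⟩ := exists_isBackwardShiftCol hcR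
    refine ⟨bb, cc, hbb, hcc, ?_⟩
    -- The squared defect of the column is `D² - a(R)* a(R)`, whose Szegő infimum is `0`. In the
    -- norm formulas, `|a(0)|²` for the column thus takes the place of `‖residual‖²` for `b`.
    have hres := hS.residual_eq_zero_of_norm_sq_add_le (D' := defect (colR ![b, a])) fun x => by
      rw [norm_sq_defect hcR, norm_sq_colR, norm_sq_defect hbR]
      simp only [Fin.sum_univ_two, Matrix.cons_val_zero, Matrix.cons_val_one]
      linarith
    rw [← sq_eq_sq₀ (norm_nonneg _) (norm_nonneg _), hbn, hcn, hres]
    simp only [Fin.sum_univ_two, Matrix.cons_val_zero, Matrix.cons_val_one, ha0,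
      Complex.norm_real, norm_norm, norm_zero]
    ring
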